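/- Let $p_1,\dots,p_k$ be distinct real numbers, let $n_1,\dots,n_k$ be positive integers and $n=n_1+\cdots+n_k$. Let $\mathcal D(\sigma)$ be the set of Hermitian $n\times n$ complex matrices whose eigenvalues are exactly $p_1,\dots,p_k$ with multiplicities $n_1,\dots,n_k$. Then $\mathcal D(\sigma)$ is the orbit $\{UDU^{-1} : U\in U(n)\}$ of the diagonal matrix $D$ with $n_i$ consecutive diagonal entries equal to $p_i$ $(i=1,\dots,k)$, it is an embedded smooth submanifold of the real vector space of complex $n\times n$ matrices, and there are ($C^\infty$) diffeomorphisms $$\mathcal D(\sigma)\;\cong\; U(n)/\bigl(U(n_1)\times\cdots\times U(n_k)\bigr)\;\cong\; SU(n)/S\bigl(U(n_1)\times\cdots\times U(n_k)\bigr).$$ Here $U(n_1)\times\cdots\times U(n_k)$ is the subgroup of block-diagonal matrices of $U(n)$, and $S(U(n_1)\times\cdots\times U(n_k))$ is its intersection with $SU(n)$. The groups $U(n)$ and $SU(n)$ carry their smooth structures as embedded submanifolds of the space of complex $n\times n$ matrices, and each coset space carries the quotient topology and the smooth structure for which the projection from the group is a smooth submersion; these structures exist. -/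

import Mathlib

open scoped Manifold ContDiff Matrix

-- The entrywise sup norm; its topology is the product topology already carried by matrices, and
-- smoothness does not depend on the choice of a norm on this finite-dimensional space.
attribute [local instance] Matrix.normedAddCommGroup Matrix.normedSpace

namespace FlagOrbit

/-! ### Smooth manifold structures on a given topological space -/

/-- A structure of finite-dimensional smooth (`C^∞`, boundaryless) real manifold on the topological
space `X`, compatible with its given topology. -/
structure SmoothStructure (X : Type) [TopologicalSpace X] where
  /-- the dimension -/
  dim : ℕ
  /-- the atlas -/
  charted : ChartedSpace (EuclideanSpace ℝ (Fin dim)) X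
  /-- the transition maps are smooth -/
  smooth : IsManifold (𝓡 dim) ∞ X

namespace SmoothStructure

variable {X Y : Type} [TopologicalSpace X] [TopologicalSpace Y]

/-- For a map `f : X → V` to a normed space (below always the inclusion of a subset with the subspace
topology), the smooth structure `S` makes `f` a smooth embedding, that is, an immersion and a
topological embedding. When `f` is the inclusion of a subset, this says that `S` makes `X` an embedded
submanifold of `V`, and `S` is then unique up to the choice of an atlas of it. -/
def IsEmbeddedBy {V : Type} [NormedAddCommGroup V] [NormedSpace ℝ V]
    (S : SmoothStructure X) (f : X → V) : Prop :=
  letI := S.charted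
  Manifold.IsSmoothEmbedding (𝓡 S.dim) 𝓘(ℝ, V) ∞ f

/-- The smooth structure `T` on the coset space `G ⧸ H` (with the quotient topology) is the quotient
of the smooth structure `S` on `G`: the projection `G → G ⧸ H` is a submersion.
There is at most one such structure, up to the choice of an atlas of it. -/
def IsQuotientOf {G : Type} [Group G] [TopologicalSpace G] {H : Subgroup G}
    (T : SmoothStructure (G ⧸ H)) (S : SmoothStructure G) : Prop :=
  letI := S.charted
  letI := T.charted
  Manifold.IsSubmersion (𝓡 S.dim) (𝓡 T.dim) ∞ (QuotientGroup.mk : G → G ⧸ H)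

/-- There is a (`C^∞`) diffeomorphism between `(X, S)` and `(Y, T)`. -/
def Diffeomorphic (S : SmoothStructure X) (T : SmoothStructure Y) : Prop :=
  letI := S.charted
  letI := T.charted
  Nonempty (Diffeomorph (𝓡 S.dim) (𝓡 T.dim) X Y ∞)

end SmoothStructure

/-! ### The groups -/

/-- `U(n)`, a subset of the complex `n × n` matrices. -/
abbrev U (n : ℕ) := Matrix.unitaryGroup (Fin n) ℂ

/-- `SU(n)`, a subset of the complex `n × n` matrices. -/
abbrev SU (n : ℕ) := Matrix.specialUnitaryGroup (Fin n) ℂ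

/-- The inclusion `SU(n) → U(n)`. -/
def inclSU (n : ℕ) : SU n →* U n :=
  Submonoid.inclusion Matrix.specialUnitaryGroup_le_unitaryGroup

variable {n k : ℕ}

/-- The decomposition of the `n = m₁ + ⋯ + m_k` indices into consecutive blocks of sizes
`m₁, …, m_k`. -/
def blockEquiv (m : Fin k → ℕ) (hm : ∑ i, m i = n) : (Σ i, Fin (m i)) ≃ Fin n :=
  finSigmaFinEquiv.trans (finCongr hm)

/-- The block-diagonal embedding `U(m₁) × ⋯ × U(m_k) → U(n)`. -/
def blockDiag (m : Fin k → ℕ) (hm : ∑ i, m i = n) : (∀ i, U (m i)) →* U n where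
  toFun u := ⟨Matrix.reindex (blockEquiv m hm) (blockEquiv m hm)
      (Matrix.blockDiagonal' fun i => (u i : Matrix (Fin (m i)) (Fin (m i)) ℂ)), by
    rw [Matrix.mem_unitaryGroup_iff, Matrix.star_eq_conjTranspose, Matrix.conjTranspose_reindex,
      ← Matrix.coe_reindexAlgEquiv ℂ ℂ, ← map_mul,
      Matrix.blockDiagonal'_conjTranspose, ← Matrix.blockDiagonal'_mul]
    have h : (fun i => (u i : Matrix (Fin (m i)) (Fin (m i)) ℂ) * (u i).1ᴴ) = 1 := by
      funext i
      exact Matrix.mem_unitaryGroup_iff.1 (u i).2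
    rw [h, Matrix.blockDiagonal'_one, map_one]⟩
  map_one' := by
    apply Subtype.ext
    change Matrix.reindex _ _ (Matrix.blockDiagonal' (1 : ∀ i, Matrix (Fin (m i)) (Fin (m i)) ℂ)) = 1
    rw [← Matrix.coe_reindexAlgEquiv ℂ ℂ, Matrix.blockDiagonal'_one, map_one]
  map_mul' u v := by
    apply Subtype.ext
    change Matrix.reindex _ _ (Matrix.blockDiagonal' fun i => (u i).1 * (v i).1) =
      Matrix.reindex _ _ _ * Matrix.reindex _ _ _
    rw [← Matrix.coe_reindexAlgEquiv ℂ ℂ, ← map_mul, ← Matrix.blockDiagonal'_mul]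

/-- `U(m₁) × ⋯ × U(m_k)` as the subgroup of block-diagonal matrices of `U(n)`. -/
def blockU (m : Fin k → ℕ) (hm : ∑ i, m i = n) : Subgroup (U n) :=
  (blockDiag m hm).range

/-- `S(U(m₁) × ⋯ × U(m_k))`: the block-diagonal matrices that lie in `SU(n)`. -/
def blockSU (m : Fin k → ℕ) (hm : ∑ i, m i = n) : Subgroup (SU n) :=
  (blockU m hm).comap (inclSU n)

/-! ### Hermitian matrices with a fixed spectrum -/

/-- `𝒟(σ)`: the Hermitian `n × n` matrices whose spectrum consists of the values `p i` with
multiplicities `m i`. -/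
def isospectral (n : ℕ) (p : Fin k → ℝ) (m : Fin k → ℕ) : Set (Matrix (Fin n) (Fin n) ℂ) :=
  {ρ | ρ.IsHermitian ∧ ρ.charpoly.roots = ∑ i, m i • ({(p i : ℂ)} : Multiset ℂ)}

/-- The real diagonal matrix with `m i` consecutive entries equal to `p i`, for `i = 1, …, k`. -/
def diagMatrix (p : Fin k → ℝ) (m : Fin k → ℕ) (hm : ∑ i, m i = n) :
    Matrix (Fin n) (Fin n) ℂ :=
  Matrix.diagonal fun a => (p ((blockEquiv m hm).symm a).1 : ℂ)

/-- The orbit of `D` under the action of `U(n)` by conjugation. -/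
def unitaryOrbit (D : Matrix (Fin n) (Fin n) ℂ) : Set (Matrix (Fin n) (Fin n) ℂ) :=
  Set.range fun g : U n => (g : Matrix (Fin n) (Fin n) ℂ) * D * ((g⁻¹ : U n) : Matrix (Fin n) (Fin n) ℂ)

end FlagOrbit

/-!
Let `D = diagR d` be the real diagonal matrix. By the spectral theorem two Hermitian matrices with
the same spectrum are unitarily conjugate, so the isospectral set is the unitary orbit of `D`
(`isospectral_eq_orbit`), and the stabilizer of `D` consists of the block-diagonal matrices
(`mem_blockU_iff`), the values `p i` being distinct.

The smooth structures come from explicit coordinates. Let `𝔤` be the Lie algebra of the group, let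
`T` be the space `tangent d` of Hermitian matrices whose entries `(a, b)` with `d a = d b` vanish,
and let `commInv d` be the explicit right inverse on `T` of the commutator
`comm d : A ↦ A D - D A`. Two maps from the space of matrices to itself, with derivative the identity
at `0`, flatten the orbit and the group.

* `orbitParam d` conjugates by `exp (commInv d B)` for the component `B` of its argument in `T`, and
  translates `D` by the other components. Near `0` it maps exactly `T` into the orbit
  (`eventually_orbitParam_mem_iff`), because `D` is isolated among the points of the orbit that
  commute with it (`eventually_eq_zero_of_mem_orbit`).
* `groupParam d` is `K + L ↦ exp K * exp L` for `K` in the image of `commInv d` and `L` commuting with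
  `D`. Near `0` it maps exactly `𝔤` into the group (`eventually_groupParam_mem_iff`).

Their local inverses, given by the inverse function theorem, are slice charts at one point, and left
multiplication and conjugation carry them to all points (`hasSlices`,
`hasSlices_of_range_eq_orbit`). This makes the group and the orbit embedded submanifolds. In these
charts the orbit map `g ↦ g D g⁻¹` is the linear surjection `comm d : 𝔤 → T` (`groupParam_conj`), so
it is a submersion (`isSubmersion`), and the parametrization gives smooth local sections of it
(`exists_section`). The coset space is therefore homeomorphic to the orbit and inherits its smooth
structure (`exists_structures`).

For arbitrary atlases satisfying the hypotheses, the bijection from the coset space to the orbit is a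
diffeomorphism (`diffeomorphic_of_lift`): a map to an embedded submanifold is smooth when it is smooth
into the ambient space, a map from the coset space is smooth when it is smooth on the group, by local
sections of the projection, and the inverse is locally a section of the orbit map followed by the
projection.

All this uses only the properties listed in `ActsTransitively`, which hold for `U(n)` and for `SU(n)`:
the values of `commInv d` have trace `0`, and a unitary matrix is a scalar of modulus `1` times one
of determinant `1`. Both coset spaces are thus diffeomorphic to the same orbit, and so to each other.
-/

namespace FlagOrbit

open Set Topology Function

/-! ### Slice charts and embedded submanifolds -/

section Slice

variable {V E F X : Type*} [NormedAddCommGroup V] [NormedSpace ℝ V] [NormedAddCommGroup E]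
  [NormedSpace ℝ E] [NormedAddCommGroup F] [NormedSpace ℝ F] [TopologicalSpace X]

/-- A slice chart of the subset `Y` of the normed space `V`: a smooth coordinate system
`V ⊇ Φ.source → E × F` with smooth inverse in which `Y` is the subspace `E × 0`. -/
structure IsSliceChart (Y : Set V) (Φ : OpenPartialHomeomorph V (E × F)) : Prop where
  contDiffOn : ContDiffOn ℝ ∞ Φ Φ.source
  contDiffOn_symm : ContDiffOn ℝ ∞ Φ.symm Φ.target
  mem_iff : ∀ y ∈ Φ.source, y ∈ Y ↔ (Φ y).2 = 0

namespace IsSliceChart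

variable {Y : Set V} {Φ : OpenPartialHomeomorph V (E × F)}

theorem symm_mem (h : IsSliceChart Y Φ) {u : E} (hu : (u, 0) ∈ Φ.target) :
    Φ.symm (u, 0) ∈ Y := by
  rw [h.mem_iff _ (Φ.map_target hu), Φ.right_inv hu]

theorem eq_of_mem (h : IsSliceChart Y Φ) {y : V} (hy : y ∈ Φ.source) (hY : y ∈ Y) :
    Φ y = ((Φ y).1, 0) :=
  Prod.ext rfl ((h.mem_iff y hy).1 hY)

/-- Slice charts of `Y` are carried to slice charts by the linear automorphisms preserving `Y`. -/
theorem translate (h : IsSliceChart Y Φ) (e : V ≃L[ℝ] V) (he : ∀ y, e y ∈ Y ↔ y ∈ Y) :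
    IsSliceChart Y (e.toHomeomorph.transOpenPartialHomeomorph Φ) where
  contDiffOn := h.contDiffOn.comp e.contDiff.contDiffOn fun _ hy => hy
  contDiffOn_symm := e.symm.contDiff.comp_contDiffOn h.contDiffOn_symm
  mem_iff y hy := (he y).symm.trans (h.mem_iff (e y) hy)

variable {ι : X → V} [Nonempty X]

omit [TopologicalSpace X] in
theorem map_invFun (h : IsSliceChart (range ι) Φ) {u : E} (hu : (u, 0) ∈ Φ.target) :
    ι (invFun ι (Φ.symm (u, 0))) = Φ.symm (u, 0) :=
  invFun_eq (h.symm_mem hu)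

/-- The chart induced on `X` by a slice chart of the range of an embedding `ι : X → V`. -/
noncomputable def chart (h : IsSliceChart (range ι) Φ) (hι : IsEmbedding ι) :
    OpenPartialHomeomorph X E where
  toFun x := (Φ (ι x)).1
  invFun u := invFun ι (Φ.symm (u, 0))
  source := ι ⁻¹' Φ.source
  target := (fun u => (u, 0)) ⁻¹' Φ.target
  map_source' x hx := by
    change ((Φ (ι x)).1, (0 : F)) ∈ Φ.target
    rw [← h.eq_of_mem hx (mem_range_self x)]
    exact Φ.map_source hx
  map_target' u hu := by
    change ι _ ∈ Φ.source
    rw [h.map_invFun hu]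
    exact Φ.map_target hu
  left_inv' x hx := by
    rw [← h.eq_of_mem hx (mem_range_self x), Φ.left_inv hx]
    exact leftInverse_invFun hι.injective x
  right_inv' u hu := by
    rw [h.map_invFun hu, Φ.right_inv hu]
  open_source := Φ.open_source.preimage hι.continuous
  open_target := Φ.open_target.preimage (by fun_prop)
  continuousOn_toFun := continuous_fst.comp_continuousOn
    (Φ.continuousOn.comp hι.continuous.continuousOn fun _ hx => hx)
  continuousOn_invFun := by
    rw [hι.isInducing.continuousOn_iff]
    refine ContinuousOn.congr (f := fun u => Φ.symm (u, 0)) ?_ fun u hu => h.map_invFun hu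
    exact Φ.continuousOn_symm.comp (by fun_prop) fun _ hu => hu

theorem map_chart_symm (h : IsSliceChart (range ι) Φ) (hι : IsEmbedding ι) {u : E}
    (hu : u ∈ (h.chart hι).target) : ι ((h.chart hι).symm u) = Φ.symm (u, 0) :=
  h.map_invFun hu

theorem contDiffOn_transition {Φ' : OpenPartialHomeomorph V (E × F)}
    (h : IsSliceChart (range ι) Φ) (h' : IsSliceChart (range ι) Φ') (hι : IsEmbedding ι) :
    ContDiffOn ℝ ∞ ((h.chart hι).symm ≫ₕ h'.chart hι)
      ((h.chart hι).symm ≫ₕ h'.chart hι).source := by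
  have key : ContDiffOn ℝ ∞ (fun u => (Φ' (Φ.symm (u, 0))).1)
      ((h.chart hι).symm ≫ₕ h'.chart hι).source := by
    refine contDiff_fst.comp_contDiffOn (h'.contDiffOn.comp
      (h.contDiffOn_symm.comp (t := Φ.target) (by fun_prop) fun u hu => hu.1) fun u hu => ?_)
    have h2 : ι ((h.chart hι).symm u) ∈ Φ'.source := hu.2
    rwa [h.map_chart_symm hι hu.1] at h2
  refine key.congr fun u hu => ?_
  change (Φ' (ι ((h.chart hι).symm u))).1 = _
  rw [h.map_chart_symm hι hu.1]

end IsSliceChart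

end Slice

section Structures

variable {V F X : Type} [NormedAddCommGroup V] [NormedSpace ℝ V] [NormedAddCommGroup F]
  [NormedSpace ℝ F] [TopologicalSpace X] [Nonempty X] {d : ℕ} {ι : X → V}

/-- The range of `ι` has a slice chart around each of its points, with fixed model spaces. -/
def HasSlices (d : ℕ) (F : Type) [NormedAddCommGroup F] [NormedSpace ℝ F] (ι : X → V) : Prop :=
  ∀ x, ∃ Φ : OpenPartialHomeomorph V (EuclideanSpace ℝ (Fin d) × F),
    IsSliceChart (range ι) Φ ∧ ι x ∈ Φ.source

/-- The charted space structure on `X` pulled back along an embedding `ι : X → V` whose range has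
slice charts; its atlas consists of all charts induced by slice charts. -/
@[reducible]
noncomputable def HasSlices.chartedSpace (H : HasSlices d F ι) (hι : IsEmbedding ι) :
    ChartedSpace (EuclideanSpace ℝ (Fin d)) X where
  atlas := {φ | ∃ (Φ : OpenPartialHomeomorph V (EuclideanSpace ℝ (Fin d) × F))
    (h : IsSliceChart (range ι) Φ), φ = h.chart hι}
  chartAt x := (H x).choose_spec.1.chart hι
  mem_chart_source x := (H x).choose_spec.2
  chart_mem_atlas _ := ⟨_, _, rfl⟩

theorem HasSlices.isManifold (H : HasSlices d F ι) (hι : IsEmbedding ι) :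
    letI := H.chartedSpace hι
    IsManifold (𝓡 d) ∞ X := by
  let := H.chartedSpace hι
  refine isManifold_of_contDiffOn _ _ _ ?_
  rintro _ _ ⟨Φ, h, rfl⟩ ⟨Φ', h', rfl⟩
  simpa using h.contDiffOn_transition h' hι

/-- The smooth structure on `X` pulled back along an embedding `ι : X → V` whose range has slice
charts. -/
noncomputable def HasSlices.smoothStructure (H : HasSlices d F ι) (hι : IsEmbedding ι) :
    SmoothStructure X :=
  ⟨d, H.chartedSpace hι, H.isManifold hι⟩

theorem HasSlices.chart_mem_maximalAtlas (H : HasSlices d F ι) (hι : IsEmbedding ι)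
    {Φ : OpenPartialHomeomorph V (EuclideanSpace ℝ (Fin d) × F)}
    (h : IsSliceChart (range ι) Φ) :
    letI := H.chartedSpace hι
    h.chart hι ∈ IsManifold.maximalAtlas (𝓡 d) ∞ X := by
  let := H.chartedSpace hι
  have := H.isManifold hι
  exact IsManifold.subset_maximalAtlas ⟨Φ, h, rfl⟩

theorem HasSlices.isSmoothEmbedding (H : HasSlices d F ι) (hι : IsEmbedding ι)
    (e : (EuclideanSpace ℝ (Fin d) × F) ≃L[ℝ] V) :
    letI := H.chartedSpace hι
    Manifold.IsSmoothEmbedding (𝓡 d) 𝓘(ℝ, V) ∞ ι := by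
  let := H.chartedSpace hι
  refine ⟨Manifold.IsImmersionOfComplement.isImmersion (F := F) fun x => ?_, hι⟩
  obtain ⟨Φ, h, hx⟩ := H x
  refine Manifold.IsImmersionAtOfComplement.mk_of_continuousAt hι.continuous.continuousAt e
    (h.chart hι) (Φ.trans e.toHomeomorph.toOpenPartialHomeomorph) hx (by simpa using hx)
    (H.chart_mem_maximalAtlas hι h) ?_ ?_
  · apply OpenPartialHomeomorph.mem_maximalAtlas_of_contMDiffOn
    · rw [contMDiffOn_iff_contDiffOn]
      exact (e.contDiff.comp_contDiffOn h.contDiffOn).mono (by simp)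
    · rw [contMDiffOn_iff_contDiffOn]
      exact h.contDiffOn_symm.comp e.symm.contDiff.contDiffOn fun y hy => hy.2
  · intro u hu
    have hu' : u ∈ (h.chart hι).target := by simpa using hu
    have h2 : (u, 0) ∈ Φ.target := hu'
    simp [h.map_chart_symm hι hu', Φ.right_inv h2]

theorem HasSlices.isEmbeddedBy (H : HasSlices d F ι) (hι : IsEmbedding ι)
    (e : (EuclideanSpace ℝ (Fin d) × F) ≃L[ℝ] V) :
    (H.smoothStructure hι).IsEmbeddedBy ι :=
  H.isSmoothEmbedding hι e

end Structures

/-! ### Submersions -/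

section Submersion

variable {M N : Type*} [TopologicalSpace M] [TopologicalSpace N] {a b : ℕ}
  [ChartedSpace (EuclideanSpace ℝ (Fin a)) M] [ChartedSpace (EuclideanSpace ℝ (Fin b)) N]

/-- A map which is a linear surjection in suitable charts around a point is a submersion there. -/
theorem isSubmersionAtOfComplement_of_surjective {f : M → N} {x : M} (hf : ContinuousAt f x)
    {φ : OpenPartialHomeomorph M (EuclideanSpace ℝ (Fin a))}
    {ψ : OpenPartialHomeomorph N (EuclideanSpace ℝ (Fin b))}
    (hφ : φ ∈ IsManifold.maximalAtlas (𝓡 a) ∞ M) (hψ : ψ ∈ IsManifold.maximalAtlas (𝓡 b) ∞ N)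
    (hx : x ∈ φ.source) (hfx : f x ∈ ψ.source)
    (l : EuclideanSpace ℝ (Fin a) →L[ℝ] EuclideanSpace ℝ (Fin b)) (hl : l.range = ⊤)
    (h : ∀ᶠ y in 𝓝 x, ψ (f y) = l (φ y)) :
    Manifold.IsSubmersionAtOfComplement l.ker (𝓡 a) (𝓡 b) ∞ f x := by
  obtain ⟨s, hs, hso, hxs⟩ := eventually_nhds_iff.1 h
  obtain ⟨r, hr⟩ := l.exists_rightInverse_of_surjective hl
  refine Manifold.IsSubmersionAtOfComplement.mk_of_continuousAt hf
    (ContinuousLinearEquiv.equivOfRightInverse l r fun z => by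
      exact DFunLike.congr_fun hr z) (φ.restr s) ψ ?_ hfx
    (restr_mem_maximalAtlas _ hφ hso) hψ ?_
  · rw [φ.restr_source' s hso]
    exact ⟨hx, hxs⟩
  · intro u hu
    have hu' : u ∈ (φ.restr s).target := by simpa using hu
    have h1 := (φ.restr s).map_target hu'
    rw [φ.restr_source' s hso] at h1
    have h2 := hs _ h1.2
    have h3 := (φ.restr s).right_inv hu'
    simp only [OpenPartialHomeomorph.restr_apply] at h3
    rw [h3] at h2
    exact h2

/-- A submersion has a smooth local section through every point. -/
theorem exists_local_section {f : M → N} {x : M}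
    (h : Manifold.IsSubmersionAt (𝓡 a) (𝓡 b) ∞ f x) :
    ∃ s : N → M, s (f x) = x ∧ ContMDiffAt (𝓡 b) (𝓡 a) ∞ s (f x) ∧ ∀ᶠ z in 𝓝 (f x), f (s z) = z := by
  set φ := h.domChart
  set ψ := h.codChart
  have hx : x ∈ φ.source := h.mem_domChart_source
  have hfx : f x ∈ ψ.source := h.mem_codChart_source
  have key : ∀ u ∈ φ.target, ψ (f (φ.symm u)) = (h.equiv u).1 := fun u hu => by
    have := h.writtenInCharts (show u ∈ (φ.extend (𝓡 a)).target by simpa using hu)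
    simpa using this
  let σ : EuclideanSpace ℝ (Fin b) → EuclideanSpace ℝ (Fin a) :=
    fun v => h.equiv.symm (v, (h.equiv (φ x)).2)
  have hσ : ContDiff ℝ ∞ σ := h.equiv.symm.contDiff.comp (contDiff_id.prodMk contDiff_const)
  have h0 : ψ (f x) = (h.equiv (φ x)).1 := by
    rw [← key _ (φ.map_source hx), φ.left_inv hx]
  have hσ0 : σ (ψ (f x)) = φ x := by
    simp [σ, h0]
  have hcont : ContinuousAt (fun z => σ (ψ z)) (f x) :=
    hσ.continuous.continuousAt.comp (ψ.continuousAt hfx)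
  refine ⟨fun z => φ.symm (σ (ψ z)), ?_, ?_, ?_⟩
  · simp only [hσ0, φ.left_inv hx]
  · have e1 : ContMDiffAt (𝓡 b) (𝓡 b) ∞ ψ (f x) :=
      contMDiffAt_of_mem_maximalAtlas h.codChart_mem_maximalAtlas hfx
    have e2 : ContMDiffAt (𝓡 b) (𝓡 a) ∞ σ (ψ (f x)) := hσ.contMDiff _
    have e3 : ContMDiffAt (𝓡 a) (𝓡 a) ∞ φ.symm (σ (ψ (f x))) := by
      rw [hσ0]
      exact contMDiffAt_symm_of_mem_maximalAtlas h.domChart_mem_maximalAtlas (φ.map_source hx)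
    exact ContMDiffAt.comp (f x) e3 (ContMDiffAt.comp (g := σ) (f x) e2 e1)
  · have n1 : ∀ᶠ z in 𝓝 (f x), σ (ψ z) ∈ φ.target :=
      hcont.eventually_mem (φ.open_target.mem_nhds (by rw [hσ0]; exact φ.map_source hx))
    have n2 : ∀ᶠ z in 𝓝 (f x), z ∈ ψ.source := ψ.open_source.mem_nhds hfx
    filter_upwards [n1, n2] with z hz1 hz2
    have h4 : f (φ.symm (σ (ψ z))) ∈ ψ.source :=
      h.source_subset_preimage_source (φ.map_target hz1)
    refine ψ.injOn h4 hz2 ?_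
    rw [key _ hz1]
    simp [σ]

end Submersion

/-! ### The inverse function theorem and slice charts -/

section Inverse

variable {V : Type*} [NormedAddCommGroup V] [NormedSpace ℝ V]

/-- The smooth inverse function theorem at `0`, with the inverse smooth on the whole target. -/
theorem exists_smooth_local_inverse [CompleteSpace V] {Ψ : V → V} (h : ContDiff ℝ ∞ Ψ)
    (h' : HasFDerivAt Ψ (ContinuousLinearMap.id ℝ V) 0) {N : Set V} (hN : N ∈ 𝓝 0) :
    ∃ Θ : OpenPartialHomeomorph V V, ⇑Θ = Ψ ∧ 0 ∈ Θ.source ∧ Θ.source ⊆ N ∧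
      ContDiffOn ℝ ∞ Θ.symm Θ.target := by
  have h0 : ContDiffAt ℝ ∞ Ψ 0 := h.contDiffAt
  have h'' : HasFDerivAt Ψ ((ContinuousLinearEquiv.refl ℝ V : V ≃L[ℝ] V) : V →L[ℝ] V) 0 := h'
  let Θ₀ := h0.toOpenPartialHomeomorph Ψ h'' (by simp)
  -- The derivative stays invertible near `0`, which makes the inverse smooth there.
  have hinv : {x | fderiv ℝ Ψ x ∈ range ((↑) : (V ≃L[ℝ] V) → V →L[ℝ] V)} ∈ 𝓝 (0 : V) := by
    refine (h.continuous_fderiv (by simp)).continuousAt.preimage_mem_nhds ?_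
    rw [h''.fderiv]
    exact ContinuousLinearEquiv.nhds _
  obtain ⟨s, hs, hso, h0s⟩ := mem_nhds_iff.1 (Filter.inter_mem hinv hN)
  have hsrc : (Θ₀.restr s).source = Θ₀.source ∩ s := Θ₀.restr_source' s hso
  refine ⟨Θ₀.restr s, rfl, ?_, ?_, ?_⟩
  · rw [hsrc]
    exact ⟨h0.mem_toOpenPartialHomeomorph_source h'' (by simp), h0s⟩
  · rw [hsrc]
    exact fun x hx => (hs hx.2).2
  · intro y hy
    have h1 := (Θ₀.restr s).map_target hy
    rw [hsrc] at h1
    obtain ⟨e, he⟩ := (hs h1.2).1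
    refine ((Θ₀.restr s).contDiffAt_symm (f₀' := e) hy ?_ h.contDiffAt).contDiffWithinAt
    rw [he]
    exact (h.differentiable (by simp) _).hasFDerivAt

variable {E F : Type*} [NormedAddCommGroup E] [NormedSpace ℝ E] [NormedAddCommGroup F]
  [NormedSpace ℝ F]

/-- A map `Ψ : V → V` with derivative the identity at `0` that carries, near `0`, exactly the points
of a linear subspace `W` to `Y` has a local inverse that is a slice chart of `Y`, once `W` is
identified with the factor `E` of `V ≃ E × F`. -/
theorem exists_sliceChart [CompleteSpace V] {Ψ : V → V} (h : ContDiff ℝ ∞ Ψ)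
    (h' : HasFDerivAt Ψ (ContinuousLinearMap.id ℝ V) 0) {Y : Set V} {W : Submodule ℝ V}
    (hY : ∀ᶠ A in 𝓝 0, Ψ A ∈ Y ↔ A ∈ W) (c : V ≃L[ℝ] E × F)
    (hc : ∀ A, A ∈ W ↔ (c A).2 = 0) :
    ∃ Φ : OpenPartialHomeomorph V (E × F), IsSliceChart Y Φ ∧ Ψ 0 ∈ Φ.source ∧
      (∀ᶠ A in 𝓝 0, Φ (Ψ A) = c A) ∧ ∀ z ∈ Φ.source, Ψ (c.symm (Φ z)) = z := by
  obtain ⟨Θ, rfl, h0, hs, hsymm⟩ := exists_smooth_local_inverse h h' hY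
  have hsrc : (Θ.symm.trans c.toHomeomorph.toOpenPartialHomeomorph).source = Θ.target := by simp
  have hcoe : ∀ z, (Θ.symm.trans c.toHomeomorph.toOpenPartialHomeomorph) z = c (Θ.symm z) :=
    fun _ => rfl
  refine ⟨Θ.symm.trans c.toHomeomorph.toOpenPartialHomeomorph, ⟨?_, ?_, fun y hy => ?_⟩, ?_, ?_, ?_⟩
  · exact (c.contDiff.comp_contDiffOn hsymm).mono hsrc.le
  · exact h.contDiffOn.comp (s := _) (t := Θ.source) c.symm.contDiff.contDiffOn fun y hy => hy.2
  · rw [hsrc] at hy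
    have := hs (Θ.map_target hy)
    rw [mem_ofPred_eq, Θ.right_inv hy, hc] at this
    exact this
  · rw [hsrc]
    exact Θ.map_source h0
  · filter_upwards [Θ.open_source.mem_nhds h0] with A hA
    rw [hcoe, Θ.left_inv hA]
  · intro z hz
    rw [hsrc] at hz
    rw [hcoe, c.symm_apply_apply, Θ.right_inv hz]

/-- A subspace of a finite-dimensional space is a coordinate subspace. -/
theorem exists_coordinates [FiniteDimensional ℝ V] (W : Submodule ℝ V) :
    ∃ (W' : Submodule ℝ V) (c : V ≃L[ℝ] EuclideanSpace ℝ (Fin (Module.finrank ℝ W)) × W'),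
      ∀ A, A ∈ W ↔ (c A).2 = 0 := by
  obtain ⟨W', hW'⟩ := W.exists_isCompl
  let e := (Submodule.prodEquivOfIsCompl W W' hW').symm.toContinuousLinearEquiv
  let e' : W ≃L[ℝ] EuclideanSpace ℝ (Fin (Module.finrank ℝ W)) :=
    ContinuousLinearEquiv.ofFinrankEq (by simp)
  refine ⟨W', e.trans (e'.prodCongr (ContinuousLinearEquiv.refl ℝ W')), fun A => ?_⟩
  exact (Submodule.prodEquivOfIsCompl_symm_apply_snd_eq_zero W W' hW').symm

end Inverse

/-! ### Calculus in the matrix algebra -/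

section Calculus

variable {ν : Type} [Fintype ν] [DecidableEq ν]

theorem isBoundedBilinearMap_matrix_mul :
    IsBoundedBilinearMap ℝ fun P : Matrix ν ν ℂ × Matrix ν ν ℂ => P.1 * P.2 :=
  (LinearMap.mul ℝ (Matrix ν ν ℂ)).toContinuousBilinearMap.isBoundedBilinearMap

variable {W : Type*} [NormedAddCommGroup W] [NormedSpace ℝ W] {f g : W → Matrix ν ν ℂ}

theorem _root_.ContDiff.matrix_mul (hf : ContDiff ℝ ∞ f) (hg : ContDiff ℝ ∞ g) :
    ContDiff ℝ ∞ fun x => f x * g x :=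
  isBoundedBilinearMap_matrix_mul.contDiff.comp (hf.prodMk hg)

theorem _root_.ContDiffAt.matrix_mul {x : W} (hf : ContDiffAt ℝ ∞ f x) (hg : ContDiffAt ℝ ∞ g x) :
    ContDiffAt ℝ ∞ (fun x => f x * g x) x :=
  isBoundedBilinearMap_matrix_mul.contDiff.contDiffAt.comp x (hf.prodMk hg)

theorem _root_.HasFDerivAt.matrix_mul {x : W} {f' g' h' : W →L[ℝ] Matrix ν ν ℂ}
    (hf : HasFDerivAt f f' x) (hg : HasFDerivAt g g' x)
    (hh : ∀ v, h' v = f' v * g x + f x * g' v) : HasFDerivAt (fun x => f x * g x) h' x := by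
  have := (isBoundedBilinearMap_matrix_mul.hasFDerivAt (f x, g x)).comp x (hf.prodMk hg)
  convert! this using 1
  ext1 v
  rw [hh v, add_comm]
  rfl

omit [DecidableEq ν] in
theorem contDiff_conjTranspose : ContDiff ℝ ∞ fun A : Matrix ν ν ℂ => Aᴴ := by
  let l : Matrix ν ν ℂ →ₗ[ℝ] Matrix ν ν ℂ :=
    { toFun := fun A => Aᴴ
      map_add' := Matrix.conjTranspose_add
      map_smul' := fun r A => by simp [Matrix.conjTranspose_smul] }
  exact l.toContinuousLinearMap.contDiff

/-- The algebra isomorphism from matrices to operators, as a continuous linear equivalence. -/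
noncomputable def matrixEquivOperator :
    Matrix ν ν ℂ ≃L[ℂ] (EuclideanSpace ℂ ν →L[ℂ] EuclideanSpace ℂ ν) :=
  (Matrix.toEuclideanCLM (n := ν) (𝕜 := ℂ)).toAlgEquiv.toLinearEquiv.toContinuousLinearEquiv

theorem matrixEquivOperator_pow (A : Matrix ν ν ℂ) (k : ℕ) :
    matrixEquivOperator (A ^ k) = matrixEquivOperator A ^ k :=
  map_pow (Matrix.toEuclideanCLM (n := ν) (𝕜 := ℂ)) A k

/-- The exponential of matrices, transported to the normed algebra of operators. The entrywise norm
is not submultiplicative, so the results on normed algebras do not apply to it directly. -/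
theorem exp_eq_comp : (NormedSpace.exp : Matrix ν ν ℂ → Matrix ν ν ℂ) =
    matrixEquivOperator.symm ∘ NormedSpace.exp ∘ matrixEquivOperator := by
  funext A
  rw [comp_apply, comp_apply, ContinuousLinearEquiv.eq_symm_apply, NormedSpace.exp_eq_tsum ℂ,
    NormedSpace.exp_eq_tsum ℂ]
  simp only [ContinuousLinearEquiv.map_tsum, map_smul, matrixEquivOperator_pow]

theorem contDiff_matrix_exp :
    ContDiff ℝ ∞ (NormedSpace.exp : Matrix ν ν ℂ → Matrix ν ν ℂ) := by
  rw [exp_eq_comp]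
  have h : ContDiff ℂ ∞ (NormedSpace.exp : (EuclideanSpace ℂ ν →L[ℂ] EuclideanSpace ℂ ν) → _) :=
    contDiff_iff_contDiffAt.2 fun x => (NormedSpace.exp_analytic (𝕂 := ℂ) x).contDiffAt
  exact (matrixEquivOperator.symm.contDiff.comp
    (h.comp matrixEquivOperator.contDiff)).restrict_scalars ℝ

/-- The derivative at `0` of an exponential transported from a normed algebra to a normed space. -/
theorem hasFDerivAt_exp_conj {V 𝔸 : Type*} [NormedAddCommGroup V] [NormedSpace ℂ V]
    [NormedSpace ℝ V] [IsScalarTower ℝ ℂ V] [NormedRing 𝔸] [NormedAlgebra ℂ 𝔸] [CompleteSpace 𝔸]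
    (e : V ≃L[ℂ] 𝔸) :
    HasFDerivAt (e.symm ∘ NormedSpace.exp ∘ e) (ContinuousLinearMap.id ℝ V) 0 := by
  have h : HasFDerivAt (NormedSpace.exp : 𝔸 → 𝔸) (ContinuousLinearMap.id ℂ 𝔸) (e 0) := by
    rw [map_zero]
    exact hasFDerivAt_exp_zero
  have h2 : HasFDerivAt (e.symm ∘ NormedSpace.exp ∘ e) (ContinuousLinearMap.id ℂ V) 0 := by
    refine (e.symm.hasFDerivAt.comp 0 (h.comp 0 e.hasFDerivAt)).congr_fderiv ?_
    ext1 v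
    exact e.symm_apply_apply v
  exact h2.restrictScalars ℝ

theorem hasFDerivAt_matrix_exp_zero :
    HasFDerivAt (NormedSpace.exp : Matrix ν ν ℂ → Matrix ν ν ℂ)
      (ContinuousLinearMap.id ℝ (Matrix ν ν ℂ)) 0 := by
  rw [exp_eq_comp]
  exact hasFDerivAt_exp_conj (matrixEquivOperator (ν := ν))

theorem hasFDerivAt_exp_comp_zero (l : Matrix ν ν ℂ →L[ℝ] Matrix ν ν ℂ) :
    HasFDerivAt (fun A => NormedSpace.exp (l A)) l 0 := by
  have h := hasFDerivAt_matrix_exp_zero (ν := ν)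
  rw [← map_zero l] at h
  exact h.comp 0 l.hasFDerivAt

theorem contDiff_exp_comp (l : Matrix ν ν ℂ →L[ℝ] Matrix ν ν ℂ) :
    ContDiff ℝ ∞ fun A => NormedSpace.exp (l A) :=
  contDiff_matrix_exp.comp l.contDiff

theorem exp_mul_exp_neg (A : Matrix ν ν ℂ) :
    NormedSpace.exp A * NormedSpace.exp (-A) = 1 := by
  rw [← Matrix.exp_add_of_commute _ _ (Commute.refl A).neg_right, add_neg_cancel, NormedSpace.exp_zero]

/-- The exponential of a skew-Hermitian matrix is unitary. -/
theorem exp_mem_unitary {A : Matrix ν ν ℂ} (hA : Aᴴ = -A) :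
    NormedSpace.exp A ∈ Matrix.unitaryGroup ν ℂ := by
  rw [Matrix.mem_unitaryGroup_iff, Matrix.star_eq_conjTranspose, ← Matrix.exp_conjTranspose, hA,
    exp_mul_exp_neg]

/-- Near `0`, only skew-Hermitian matrices have a unitary exponential. -/
theorem eventually_skew_of_exp_unitary :
    ∀ᶠ A in 𝓝 (0 : Matrix ν ν ℂ), NormedSpace.exp A ∈ Matrix.unitaryGroup ν ℂ → Aᴴ = -A := by
  obtain ⟨Θ, hΘ, h0, -, -⟩ := exists_smooth_local_inverse (contDiff_matrix_exp (ν := ν))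
    hasFDerivAt_matrix_exp_zero Filter.univ_mem
  have h1 : ∀ᶠ A in 𝓝 (0 : Matrix ν ν ℂ), Aᴴ ∈ Θ.source :=
    (contDiff_conjTranspose (ν := ν)).continuous.continuousAt.eventually_mem
      (Θ.open_source.mem_nhds (by simpa using h0))
  have h2 : ∀ᶠ A in 𝓝 (0 : Matrix ν ν ℂ), -A ∈ Θ.source :=
    continuous_neg.continuousAt.eventually_mem (Θ.open_source.mem_nhds (by simpa using h0))
  filter_upwards [h1, h2] with A hA1 hA2 hA
  -- `exp` is injective near `0`, and `exp Aᴴ` and `exp (-A)` are both inverse to `exp A`.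
  refine Θ.injOn hA1 hA2 ?_
  rw [hΘ, Matrix.exp_conjTranspose]
  rw [Matrix.mem_unitaryGroup_iff', Matrix.star_eq_conjTranspose] at hA
  exact left_inv_eq_right_inv hA (exp_mul_exp_neg A)

/-- A skew-Hermitian matrix can be diagonalized by a unitary matrix. -/
theorem exists_diagonalization_of_skew {A : Matrix ν ν ℂ} (hA : Aᴴ = -A) :
    ∃ (u : Matrix ν ν ℂ) (v : ν → ℂ), u * star u = 1 ∧ A = u * Matrix.diagonal v * star u := by
  have hH : (Complex.I • A).IsHermitian := by
    rw [Matrix.IsHermitian, Matrix.conjTranspose_smul, hA]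
    simp
  have h := hH.spectral_theorem
  rw [Unitary.conjStarAlgAut_apply] at h
  refine ⟨hH.eigenvectorUnitary, -Complex.I • (RCLike.ofReal ∘ hH.eigenvalues), by simp, ?_⟩
  rw [Matrix.diagonal_smul, Matrix.mul_smul, Matrix.smul_mul, ← h, smul_smul]
  simp

/-- `det (exp A) = exp (tr A)` for skew-Hermitian `A`, by diagonalization. -/
theorem det_exp_of_skew {A : Matrix ν ν ℂ} (hA : Aᴴ = -A) :
    (NormedSpace.exp A).det = Complex.exp A.trace := by
  obtain ⟨u, v, hu, rfl⟩ := exists_diagonalization_of_skew hA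
  have hu' : IsUnit u := IsUnit.of_mul_eq_one _ hu
  have h1 : star u = u⁻¹ := (Matrix.inv_eq_right_inv hu).symm
  rw [h1, Matrix.exp_conj _ _ hu', Matrix.exp_diagonal, Matrix.det_conj hu', Matrix.det_diagonal,
    Matrix.trace_mul_cycle, ← h1, mul_eq_one_comm.1 hu, one_mul, Matrix.trace_diagonal,
    Complex.exp_sum]
  refine Finset.prod_congr rfl fun i _ => ?_
  rw [Pi.coe_exp, Complex.exp_eq_exp_ℂ]

/-- Near `0`, among the skew-Hermitian matrices only those of trace `0` have an exponential of
determinant `1`. -/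
theorem eventually_trace_eq_zero_of_det_exp :
    ∀ᶠ A in 𝓝 (0 : Matrix ν ν ℂ), Aᴴ = -A → (NormedSpace.exp A).det = 1 → A.trace = 0 := by
  have h : ∀ᶠ A in 𝓝 (0 : Matrix ν ν ℂ), ‖A.trace‖ < 2 * Real.pi := by
    have hc : Continuous fun A : Matrix ν ν ℂ => ‖A.trace‖ := by fun_prop
    refine hc.continuousAt.eventually_lt continuousAt_const ?_
    simp [Real.pi_pos]
  filter_upwards [h] with A hA hs hd
  rw [det_exp_of_skew hs, Complex.exp_eq_one_iff] at hd
  obtain ⟨N, hN⟩ := hd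
  rw [hN] at hA ⊢
  have h1 : |(N : ℝ)| < 1 := by
    simp [abs_of_pos Real.pi_pos] at hA
    nlinarith [Real.pi_pos]
  have h2 : |N| < 1 := by exact_mod_cast h1
  simp [Int.abs_lt_one_iff.1 h2]

end Calculus

/-! ### The linear algebra of the tangent space of the orbit -/

section Tangent

variable {ν : Type} [Fintype ν] [DecidableEq ν]

/-- The complex diagonal matrix with real diagonal entries `d`. -/
def diagR (d : ν → ℝ) : Matrix ν ν ℂ := Matrix.diagonal fun a => (d a : ℂ)

/-- The commutator `A ↦ A D - D A` with `D = diagR d`. -/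
noncomputable def comm (d : ν → ℝ) : Matrix ν ν ℂ →L[ℝ] Matrix ν ν ℂ :=
  (LinearMap.mulRight ℝ (diagR d) - LinearMap.mulLeft ℝ (diagR d)).toContinuousLinearMap

theorem comm_eq (d : ν → ℝ) (A : Matrix ν ν ℂ) : comm d A = A * diagR d - diagR d * A := rfl

theorem comm_apply (d : ν → ℝ) (A : Matrix ν ν ℂ) (a b : ν) :
    comm d A a b = A a b * ((d b : ℂ) - d a) := by
  rw [comm_eq, Matrix.sub_apply, diagR, Matrix.mul_diagonal, Matrix.diagonal_mul]
  ring

/-- The partial inverse of `comm d`: it divides the entry `(a, b)` by `d b - d a`, which gives `0`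
where `d a = d b`. -/
noncomputable def commInv (d : ν → ℝ) : Matrix ν ν ℂ →L[ℝ] Matrix ν ν ℂ :=
  LinearMap.toContinuousLinearMap
    { toFun := fun B => Matrix.of fun a b => B a b / ((d b : ℂ) - d a)
      map_add' := fun A B => by
        ext a b
        simp [add_div]
      map_smul' := fun r B => by
        ext a b
        simp [mul_div_assoc] }

omit [DecidableEq ν] in
theorem commInv_apply (d : ν → ℝ) (B : Matrix ν ν ℂ) (a b : ν) :
    commInv d B a b = B a b / ((d b : ℂ) - d a) := rfl

/-- The Hermitian part, with the entries `(a, b)` with `d a = d b` replaced by `0`. -/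
noncomputable def offHerm (d : ν → ℝ) : Matrix ν ν ℂ →L[ℝ] Matrix ν ν ℂ :=
  LinearMap.toContinuousLinearMap
    { toFun := fun B => Matrix.of fun a b => if d a = d b then 0 else (B a b + star (B b a)) / 2
      map_add' := fun A B => by
        ext a b
        by_cases h : d a = d b <;> simp [h]
        ring
      map_smul' := fun r B => by
        ext a b
        by_cases h : d a = d b <;> simp [h]
        ring }

omit [DecidableEq ν] in
theorem offHerm_apply (d : ν → ℝ) (B : Matrix ν ν ℂ) (a b : ν) :
    offHerm d B a b = if d a = d b then 0 else (B a b + star (B b a)) / 2 := rfl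

/-- The tangent space at `D = diagR d` of the unitary orbit of `D`: the Hermitian matrices whose
entries `(a, b)` with `d a = d b` vanish. -/
def tangent (d : ν → ℝ) : Submodule ℝ (Matrix ν ν ℂ) where
  carrier := {B | Bᴴ = B ∧ ∀ a b, d a = d b → B a b = 0}
  add_mem' := fun {A B} hA hB =>
    ⟨by rw [Matrix.conjTranspose_add, hA.1, hB.1], fun a b h => by
      simp [hA.2 a b h, hB.2 a b h]⟩
  zero_mem' := ⟨by simp, by simp⟩
  smul_mem' := fun r A hA =>
    ⟨by rw [Matrix.conjTranspose_smul, hA.1, star_trivial], fun a b h => by simp [hA.2 a b h]⟩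

variable (d : ν → ℝ)

omit [DecidableEq ν] in
theorem offHerm_mem (B : Matrix ν ν ℂ) : offHerm d B ∈ tangent d := by
  refine ⟨?_, fun a b h => by rw [offHerm_apply, if_pos h]⟩
  ext a b
  rw [Matrix.conjTranspose_apply, offHerm_apply, offHerm_apply]
  by_cases h : d a = d b
  · simp [h]
  · rw [if_neg h, if_neg (Ne.symm h)]
    simp [add_comm]

variable {d}

omit [DecidableEq ν] in
theorem offHerm_of_mem {B : Matrix ν ν ℂ} (hB : B ∈ tangent d) : offHerm d B = B := by
  ext a b
  rw [offHerm_apply]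
  split_ifs with h
  · exact (hB.2 a b h).symm
  · rw [← Matrix.conjTranspose_apply, hB.1]
    ring

theorem comm_commInv {B : Matrix ν ν ℂ} (hB : B ∈ tangent d) : comm d (commInv d B) = B := by
  ext a b
  rw [comm_apply, commInv_apply]
  by_cases h : d a = d b
  · simp [h, hB.2 a b h]
  · have : (d b : ℂ) - d a ≠ 0 := by
      rw [sub_ne_zero]
      exact_mod_cast Ne.symm h
    field_simp

omit [DecidableEq ν] in
theorem commInv_skew {B : Matrix ν ν ℂ} (hB : Bᴴ = B) : (commInv d B)ᴴ = -commInv d B := by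
  ext a b
  have h : star (B b a) = B a b := by rw [← Matrix.conjTranspose_apply, hB]
  rw [Matrix.conjTranspose_apply, Matrix.neg_apply, commInv_apply, commInv_apply, star_div₀, h,
    ← div_neg, neg_sub]
  simp

omit [DecidableEq ν] in
theorem trace_commInv (B : Matrix ν ν ℂ) : (commInv d B).trace = 0 :=
  Finset.sum_eq_zero fun a _ => by simp [commInv_apply]

theorem comm_mem {A : Matrix ν ν ℂ} (hA : Aᴴ = -A) : comm d A ∈ tangent d := by
  refine ⟨?_, fun a b h => by simp [comm_apply, h]⟩
  ext a b
  have h : star (A b a) = -A a b := by rw [← Matrix.conjTranspose_apply, hA, Matrix.neg_apply]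
  rw [Matrix.conjTranspose_apply, comm_apply, comm_apply, star_mul', h]
  simp only [star_sub, Complex.star_def, Complex.conj_ofReal]
  ring

omit [Fintype ν] in
theorem diagR_isHermitian : (diagR d)ᴴ = diagR d := by
  rw [diagR, Matrix.diagonal_conjTranspose]
  congr 1
  ext a
  simp

/-- If `D + A - offHerm A` is Hermitian, then `A - offHerm A` commutes with `D`. -/
theorem comm_sub_offHerm {A : Matrix ν ν ℂ} (h : (A - offHerm d A)ᴴ = A - offHerm d A) :
    comm d (A - offHerm d A) = 0 := by
  ext a b
  rw [comm_apply]
  by_cases hab : d a = d b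
  · simp [hab]
  · have h1 := congr_fun₂ h a b
    rw [Matrix.conjTranspose_apply, Matrix.sub_apply, Matrix.sub_apply, offHerm_apply,
      offHerm_apply, if_neg hab, if_neg (Ne.symm hab)] at h1
    have h2 : A a b - (A a b + star (A b a)) / 2 = 0 := by
      simp only [star_sub, star_div₀, star_add, star_star, star_ofNat] at h1
      linear_combination (-1/2) * h1
    rw [Matrix.sub_apply, offHerm_apply, if_neg hab, h2, zero_mul, Matrix.zero_apply]

end Tangent

/-! ### The local structure of the orbit -/

section Orbit

variable {ν : Type} [Fintype ν] [DecidableEq ν]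

open Polynomial in
/-- A matrix intertwining `X` and `Y` intertwines `q X` and `q Y`, for every polynomial `q`. -/
theorem aeval_mul_eq_mul_aeval {X Y E : Matrix ν ν ℂ} (h : X * E = E * Y) (q : ℝ[X]) :
    aeval X q * E = E * aeval Y q := by
  induction q using Polynomial.induction_on' with
  | add p q hp hq => rw [map_add, map_add, add_mul, mul_add, hp, hq]
  | monomial k r =>
    have hk : X ^ k * E = E * Y ^ k := (SemiconjBy.pow_right (a := E) (x := Y) (y := X) h.symm k).symm
    rw [aeval_monomial, aeval_monomial, mul_assoc, hk, ← mul_assoc, ← mul_assoc,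
      Algebra.commutes]

/-- The orbit of `D = diagR d` under conjugation by unitary matrices. -/
def orbit (d : ν → ℝ) : Set (Matrix ν ν ℂ) :=
  {B | ∃ u ∈ Matrix.unitaryGroup ν ℂ, B = u * diagR d * star u}

open Polynomial in
/-- The orbit of `D` is cut out near `D`, in the directions commuting with `D`, by the equation
`∏ (X - d a) = 0` alone: `D` is isolated among its conjugates `D + R` commuting with it. -/
theorem eventually_eq_zero_of_mem_orbit (d : ν → ℝ) :
    ∀ᶠ R in 𝓝 (0 : Matrix ν ν ℂ), comm d R = 0 → diagR d + R ∈ orbit d → R = 0 := by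
  let S : Finset ℝ := Finset.univ.image d
  let q : ℝ[X] := ∏ s ∈ S, (X - C s)
  let w (a : ν) : ℝ[X] := ∏ s ∈ S.erase (d a), (X - C s)
  have hS : ∀ a, d a ∈ S := fun a => Finset.mem_image_of_mem d (Finset.mem_univ a)
  have hq : ∀ a, q = (X - C (d a)) * w a := fun a => (Finset.mul_prod_erase S _ (hS a)).symm
  have hqD : aeval (diagR d) q = 0 := by
    have : diagR d = Matrix.diagonalAlgHom ℝ (fun a => (d a : ℂ)) := rfl
    have h0 : aeval (fun a => (d a : ℂ)) q = 0 := by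
      funext a
      rw [← Pi.evalAlgHom_apply ℝ (fun _ : ν => ℂ) a (aeval _ q), ← aeval_algHom_apply]
      simp [hq a]
    rw [this, aeval_algHom_apply, h0, map_zero]
  have hunit : ∀ᶠ R in 𝓝 (0 : Matrix ν ν ℂ), ∀ a,
      IsUnit (aeval (algebraMap ℝ (Matrix ν ν ℂ) (d a) + R) (w a)) := by
    refine Filter.eventually_all.2 fun a => ?_
    have hc : Continuous fun R : Matrix ν ν ℂ =>
        (aeval (algebraMap ℝ (Matrix ν ν ℂ) (d a) + R) (w a)).det :=
      ((Polynomial.continuous_aeval (w a)).comp (continuous_const.add continuous_id)).matrix_det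
    have h0 : (aeval (algebraMap ℝ (Matrix ν ν ℂ) (d a) + 0) (w a)).det ≠ 0 := by
      rw [add_zero, aeval_algebraMap_apply, ← isUnit_iff_ne_zero, ← Matrix.isUnit_iff_isUnit_det]
      refine IsUnit.map _ (isUnit_iff_ne_zero.2 ?_)
      simp only [w, coe_aeval_eq_eval, eval_prod, eval_sub, eval_X, eval_C]
      exact Finset.prod_ne_zero_iff.2 fun s hs => sub_ne_zero.2 (Finset.ne_of_mem_erase hs).symm
    filter_upwards [hc.continuousAt.eventually_ne h0] with R hR
    exact (Matrix.isUnit_iff_isUnit_det _).2 (isUnit_iff_ne_zero.2 hR)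
  filter_upwards [hunit] with R hR hcomm horb
  obtain ⟨u, hu, hDR⟩ := horb
  have hqR : aeval (diagR d + R) q = 0 := by
    have h1 : (diagR d + R) * u = u * diagR d := by
      rw [hDR, mul_assoc, Matrix.mem_unitaryGroup_iff'.1 hu, mul_one]
    have h2 := aeval_mul_eq_mul_aeval h1 q
    rw [hqD, mul_zero] at h2
    rw [← mul_one (aeval (diagR d + R) q), ← Matrix.mem_unitaryGroup_iff.1 hu, ← mul_assoc, h2,
      zero_mul]
  have hRab : ∀ a b, d a ≠ d b → R a b = 0 := fun a b hab => by
    have := congr_fun₂ hcomm a b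
    rw [comm_apply, Matrix.zero_apply, mul_eq_zero, sub_eq_zero] at this
    exact this.resolve_right fun h => hab (by exact_mod_cast h.symm)
  ext a b
  -- The projection onto the eigenspace of `D` for `d a`.
  let E : Matrix ν ν ℂ := Matrix.diagonal fun c => if d c = d a then 1 else 0
  have hE : (diagR d + R) * E = E * (algebraMap ℝ (Matrix ν ν ℂ) (d a) + R) := by
    ext c e
    rw [Matrix.mul_diagonal, Matrix.diagonal_mul, Matrix.add_apply, Matrix.add_apply, diagR]
    by_cases h1 : d c = d a <;> by_cases h2 : d e = d a
    · rw [if_pos h1, if_pos h2, Matrix.algebraMap_matrix_apply, Matrix.diagonal_apply]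
      simp [h1]
    · have h3 : c ≠ e := fun h => h2 (h ▸ h1)
      simp [h1, h2, h3, Matrix.algebraMap_matrix_apply, hRab c e (by rw [h1]; exact Ne.symm h2)]
    · have h3 : c ≠ e := fun h => h1 (h ▸ h2)
      simp [h1, h2, h3, hRab c e (by rw [h2]; exact h1)]
    · simp [h1, h2]
  have h3 := aeval_mul_eq_mul_aeval hE q
  -- `q (D + R) E = E q (d a + R)`, and `q (d a + R)` is `R` times an invertible matrix.
  rw [hqR, zero_mul, hq a, map_mul, map_sub, aeval_X, aeval_C, add_sub_cancel_left,
    ← mul_assoc] at h3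
  have h4 : E * R = 0 := (hR a).mul_left_eq_zero.1 h3.symm
  have h5 := congr_fun₂ h4 a b
  rwa [Matrix.diagonal_mul, if_pos rfl, one_mul] at h5

end Orbit

/-! ### Coordinates adapted to the orbit and to the group -/

section OrbitParam

variable {ν : Type} [Fintype ν] [DecidableEq ν] (d : ν → ℝ)

theorem conj_mem_orbit_iff {u : Matrix ν ν ℂ} (hu : u ∈ Matrix.unitaryGroup ν ℂ)
    (B : Matrix ν ν ℂ) : u * B * star u ∈ orbit d ↔ B ∈ orbit d := by
  have key : ∀ {v B : Matrix ν ν ℂ}, v ∈ Matrix.unitaryGroup ν ℂ → B ∈ orbit d →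
      v * B * star v ∈ orbit d := by
    rintro v _ hv ⟨w, hw, rfl⟩
    exact ⟨v * w, mul_mem hv hw, by simp only [star_mul, mul_assoc]⟩
  refine ⟨fun h => ?_, key hu⟩
  have h2 := key (Unitary.star_mem hu) h
  have h3 : star u * (u * B * star u) * star (star u) = (star u * u) * B * (star u * u) := by
    simp only [star_star, mul_assoc]
  rwa [h3, Matrix.mem_unitaryGroup_iff'.1 hu, one_mul, mul_one] at h2

variable {d} in
theorem isHermitian_of_mem_orbit {B : Matrix ν ν ℂ} (h : B ∈ orbit d) : Bᴴ = B := by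
  obtain ⟨u, -, rfl⟩ := h
  rw [Matrix.star_eq_conjTranspose, Matrix.conjTranspose_mul, Matrix.conjTranspose_mul,
    Matrix.conjTranspose_conjTranspose, diagR_isHermitian, mul_assoc]

theorem star_exp_of_skew {A : Matrix ν ν ℂ} (hA : Aᴴ = -A) :
    star (NormedSpace.exp A) = NormedSpace.exp (-A) := by
  rw [Matrix.star_eq_conjTranspose, ← Matrix.exp_conjTranspose, hA]

/-- A local parametrization of the matrices near `D = diagR d`, with derivative the identity at
`0`: a Hermitian direction `[K, D]` tangent to the orbit acts through conjugation by `exp K`, and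
the complementary directions act by translation. -/
noncomputable def orbitParam (A : Matrix ν ν ℂ) : Matrix ν ν ℂ :=
  NormedSpace.exp (commInv d (offHerm d A)) * (diagR d + (A - offHerm d A)) *
    NormedSpace.exp (-commInv d (offHerm d A))

theorem contDiff_orbitParam : ContDiff ℝ ∞ (orbitParam d) := by
  have h1 := contDiff_exp_comp (commInv d ∘L offHerm d)
  have h2 := contDiff_exp_comp (-(commInv d ∘L offHerm d))
  have h3 : ContDiff ℝ ∞ fun A => diagR d + (A - offHerm d A) :=
    contDiff_const.add (contDiff_id.sub (offHerm d).contDiff)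
  exact (h1.matrix_mul h3).matrix_mul h2

theorem hasFDerivAt_orbitParam :
    HasFDerivAt (orbitParam d) (ContinuousLinearMap.id ℝ (Matrix ν ν ℂ)) 0 := by
  set L := commInv d ∘L offHerm d with hL
  have h1 := hasFDerivAt_exp_comp_zero L
  have h2 := hasFDerivAt_exp_comp_zero (-L)
  have h3 : HasFDerivAt (fun A => diagR d + (A - offHerm d A))
      (ContinuousLinearMap.id ℝ (Matrix ν ν ℂ) - offHerm d) 0 :=
    ((hasFDerivAt_id _).sub (offHerm d).hasFDerivAt).const_add _
  have h4 := HasFDerivAt.matrix_mul h1 h3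
    (h' := (LinearMap.mulRight ℝ (diagR d)).toContinuousLinearMap ∘L L +
      (ContinuousLinearMap.id ℝ (Matrix ν ν ℂ) - offHerm d)) fun v => by
    change L v * diagR d + (v - offHerm d v) = L v * (diagR d + (0 - offHerm d 0)) +
      NormedSpace.exp (L 0) * (v - offHerm d v)
    rw [map_zero, map_zero, sub_zero, add_zero, NormedSpace.exp_zero, one_mul]
  refine HasFDerivAt.matrix_mul h4 h2 fun v => ?_
  have h5 : L v * diagR d - diagR d * L v = offHerm d v := comm_commInv (offHerm_mem d v)
  change v = (L v * diagR d + (v - offHerm d v)) * NormedSpace.exp (-L 0) +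
    NormedSpace.exp (L 0) * (diagR d + (0 - offHerm d 0)) * (-L v)
  rw [map_zero, map_zero, neg_zero, NormedSpace.exp_zero, ← h5]
  simp only [sub_zero, add_zero, one_mul, mul_one, mul_neg]
  abel

@[simp]
theorem orbitParam_zero : orbitParam d 0 = diagR d := by
  simp [orbitParam]

variable {d} in
theorem orbitParam_of_mem {A : Matrix ν ν ℂ} (hA : A ∈ tangent d) :
    orbitParam d A = NormedSpace.exp (commInv d A) * diagR d *
      star (NormedSpace.exp (commInv d A)) := by
  rw [orbitParam, offHerm_of_mem hA, sub_self, add_zero, star_exp_of_skew (commInv_skew hA.1)]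

/-- Near `0`, `orbitParam` carries exactly the tangent vectors to the orbit: a point of the orbit is
conjugate to one whose difference from `D` commutes with `D`, and that one is `D`. -/
theorem eventually_orbitParam_mem_iff :
    ∀ᶠ A in 𝓝 (0 : Matrix ν ν ℂ), orbitParam d A ∈ orbit d ↔ A ∈ tangent d := by
  have hc : Continuous fun A : Matrix ν ν ℂ => A - offHerm d A :=
    continuous_id.sub (offHerm d).continuous
  have h0 := hc.tendsto 0
  rw [map_zero, sub_zero] at h0
  filter_upwards [h0.eventually (eventually_eq_zero_of_mem_orbit d)] with A hA
  constructor
  · intro h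
    have hs := commInv_skew (d := d) (offHerm_mem d A).1
    rw [orbitParam, ← star_exp_of_skew hs, conj_mem_orbit_iff d (exp_mem_unitary hs)] at h
    have h1 := isHermitian_of_mem_orbit h
    rw [Matrix.conjTranspose_add, diagR_isHermitian, add_right_inj] at h1
    have h2 := hA (comm_sub_offHerm h1) h
    rw [sub_eq_zero.1 h2]
    exact offHerm_mem d A
  · intro h
    rw [orbitParam_of_mem h]
    exact ⟨_, exp_mem_unitary (commInv_skew h.1), rfl⟩

/-- A local parametrization of the matrices near `1`, with derivative the identity at `0`. On
skew-Hermitian matrices it is `K + L ↦ exp K * exp L`, where `L` commutes with `D = diagR d` and `K`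
lies in the image of `commInv d`. -/
noncomputable def groupParam (A : Matrix ν ν ℂ) : Matrix ν ν ℂ :=
  NormedSpace.exp (commInv d (offHerm d (comm d A))) *
    NormedSpace.exp (A - commInv d (offHerm d (comm d A)))

theorem contDiff_groupParam : ContDiff ℝ ∞ (groupParam d) :=
  (contDiff_exp_comp (commInv d ∘L offHerm d ∘L comm d)).matrix_mul
    (contDiff_exp_comp (ContinuousLinearMap.id ℝ _ - commInv d ∘L offHerm d ∘L comm d))

theorem hasFDerivAt_groupParam :
    HasFDerivAt (groupParam d) (ContinuousLinearMap.id ℝ (Matrix ν ν ℂ)) 0 := by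
  refine HasFDerivAt.matrix_mul (hasFDerivAt_exp_comp_zero (commInv d ∘L offHerm d ∘L comm d))
    (hasFDerivAt_exp_comp_zero
      (ContinuousLinearMap.id ℝ _ - commInv d ∘L offHerm d ∘L comm d)) fun v => ?_
  set L := commInv d ∘L offHerm d ∘L comm d
  change v = L v * NormedSpace.exp (0 - L 0) + NormedSpace.exp (L 0) * (v - L v)
  rw [map_zero, sub_zero, NormedSpace.exp_zero]
  simp

@[simp]
theorem groupParam_zero : groupParam d 0 = 1 := by
  simp [groupParam]

variable {d} in
/-- Conjugating `D` in the coordinates `groupParam` and `orbitParam` is the linear map `comm d`. -/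
theorem groupParam_conj {A : Matrix ν ν ℂ} (hA : Aᴴ = -A) :
    groupParam d A * diagR d * star (groupParam d A) = orbitParam d (comm d A) := by
  have hm := comm_mem (d := d) hA
  rw [orbitParam_of_mem hm, groupParam, offHerm_of_mem hm]
  set K := commInv d (comm d A) with hK
  have hs : Kᴴ = -K := commInv_skew hm.1
  have h1 : Commute (A - K) (diagR d) := by
    have : comm d (A - K) = 0 := by rw [map_sub, hK, comm_commInv hm, sub_self]
    exact sub_eq_zero.1 this
  have h2 : Commute (NormedSpace.exp (A - K)) (diagR d) := h1.exp_left
  have h3 : NormedSpace.exp (A - K) ∈ Matrix.unitaryGroup ν ℂ :=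
    exp_mem_unitary (by rw [Matrix.conjTranspose_sub, hA, hs, neg_sub_neg, neg_sub])
  calc _ = NormedSpace.exp K * (NormedSpace.exp (A - K) * diagR d) *
        star (NormedSpace.exp (A - K)) * star (NormedSpace.exp K) := by
        simp only [star_mul, mul_assoc]
    _ = NormedSpace.exp K * diagR d * (NormedSpace.exp (A - K) *
        star (NormedSpace.exp (A - K))) * star (NormedSpace.exp K) := by
        rw [h2.eq]
        simp only [mul_assoc]
    _ = _ := by rw [Matrix.mem_unitaryGroup_iff.1 h3, mul_one]

end OrbitParam

/-! ### Matrix groups acting transitively on the orbit -/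

section Group

variable {ν : Type} [Fintype ν] [DecidableEq ν]

/-- Left multiplication by `u⁻¹ = star u`, for unitary `u`. -/
noncomputable def leftEquiv {u : Matrix ν ν ℂ} (hu : u ∈ Matrix.unitaryGroup ν ℂ) :
    Matrix ν ν ℂ ≃L[ℝ] Matrix ν ν ℂ :=
  LinearEquiv.toContinuousLinearEquiv
    { LinearMap.mulLeft ℝ (star u) with
      invFun := fun A => u * A
      left_inv := fun A => by
        change u * (star u * A) = A
        rw [← mul_assoc, Matrix.mem_unitaryGroup_iff.1 hu, one_mul]
      right_inv := fun A => by
        change star u * (u * A) = A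
        rw [← mul_assoc, Matrix.mem_unitaryGroup_iff'.1 hu, one_mul] }

theorem leftEquiv_apply {u : Matrix ν ν ℂ} (hu : u ∈ Matrix.unitaryGroup ν ℂ)
    (A : Matrix ν ν ℂ) : leftEquiv hu A = star u * A := rfl

/-- Conjugation by `u⁻¹ = star u`, for unitary `u`. -/
noncomputable def conjEquiv {u : Matrix ν ν ℂ} (hu : u ∈ Matrix.unitaryGroup ν ℂ) :
    Matrix ν ν ℂ ≃L[ℝ] Matrix ν ν ℂ :=
  LinearEquiv.toContinuousLinearEquiv
    { LinearMap.mulLeft ℝ (star u) ∘ₗ LinearMap.mulRight ℝ u with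
      invFun := fun A => u * A * star u
      left_inv := fun A => by
        change u * (star u * (A * u)) * star u = A
        rw [← mul_assoc, Matrix.mem_unitaryGroup_iff.1 hu, one_mul, mul_assoc,
          Matrix.mem_unitaryGroup_iff.1 hu, mul_one]
      right_inv := fun A => by
        change star u * ((u * A * star u) * u) = A
        rw [mul_assoc (u * A), Matrix.mem_unitaryGroup_iff'.1 hu, mul_one, ← mul_assoc,
          Matrix.mem_unitaryGroup_iff'.1 hu, one_mul] }

theorem conjEquiv_apply {u : Matrix ν ν ℂ} (hu : u ∈ Matrix.unitaryGroup ν ℂ)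
    (A : Matrix ν ν ℂ) : conjEquiv hu A = star u * (A * u) := rfl

theorem conjEquiv_conj {u : Matrix ν ν ℂ} (hu : u ∈ Matrix.unitaryGroup ν ℂ)
    (A : Matrix ν ν ℂ) : conjEquiv hu (u * A * star u) = A :=
  (conjEquiv hu).right_inv A

theorem conj_conjEquiv {u : Matrix ν ν ℂ} (hu : u ∈ Matrix.unitaryGroup ν ℂ)
    (A : Matrix ν ν ℂ) : u * conjEquiv hu A * star u = A :=
  (conjEquiv hu).left_inv A

theorem conjEquiv_mem_orbit_iff (d : ν → ℝ) {u : Matrix ν ν ℂ}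
    (hu : u ∈ Matrix.unitaryGroup ν ℂ) (A : Matrix ν ν ℂ) :
    conjEquiv hu A ∈ orbit d ↔ A ∈ orbit d := by
  rw [← conj_mem_orbit_iff d hu, conj_conjEquiv]

variable {G : Type} [Group G] [TopologicalSpace G]

/-- The topological group `G` is embedded by `ι` as a group of unitary matrices with Lie algebra
`𝔤`, in the sense that near `0` the exponential of a matrix lies in `G` exactly for the elements of
`𝔤`, and `𝔤` and `G` are large enough to act transitively on the orbit of `diagR d`, infinitesimally
and globally. -/
structure ActsTransitively (d : ν → ℝ) (ι : G →* Matrix ν ν ℂ)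
    (𝔤 : Submodule ℝ (Matrix ν ν ℂ)) : Prop where
  isEmbedding : IsEmbedding ι
  unitary : ∀ g, ι g ∈ Matrix.unitaryGroup ν ℂ
  skew : ∀ A ∈ 𝔤, Aᴴ = -A
  exp_mem : ∀ A ∈ 𝔤, NormedSpace.exp A ∈ range ι
  mem_of_exp : ∀ᶠ A in 𝓝 (0 : Matrix ν ν ℂ), NormedSpace.exp A ∈ range ι → A ∈ 𝔤
  commInv_mem : ∀ B ∈ tangent d, commInv d B ∈ 𝔤
  transitive : ∀ B ∈ orbit d, ∃ g, ι g * diagR d * star (ι g) = B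

variable {d : ν → ℝ} {ι : G →* Matrix ν ν ℂ} {𝔤 : Submodule ℝ (Matrix ν ν ℂ)}

namespace ActsTransitively

theorem map_inv (h : ActsTransitively d ι 𝔤) (g : G) : ι g⁻¹ = star (ι g) := by
  refine left_inv_eq_right_inv (a := ι g) ?_ (Matrix.mem_unitaryGroup_iff.1 (h.unitary g))
  rw [← map_mul, inv_mul_cancel, map_one]

omit [TopologicalSpace G] in
theorem mul_mem_range_iff (g : G) (A : Matrix ν ν ℂ) : ι g * A ∈ range ι ↔ A ∈ range ι := by
  constructor
  · rintro ⟨g', hg'⟩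
    refine ⟨g⁻¹ * g', ?_⟩
    rw [map_mul, hg', ← mul_assoc, ← map_mul, inv_mul_cancel, map_one, one_mul]
  · rintro ⟨g', rfl⟩
    exact ⟨g * g', map_mul ι g g'⟩

theorem leftEquiv_mem_range_iff (h : ActsTransitively d ι 𝔤) (g : G) (A : Matrix ν ν ℂ) :
    leftEquiv (h.unitary g) A ∈ range ι ↔ A ∈ range ι := by
  rw [leftEquiv_apply, ← h.map_inv]
  exact mul_mem_range_iff _ _

theorem eventually_groupParam_mem_iff (h : ActsTransitively d ι 𝔤) :
    ∀ᶠ A in 𝓝 (0 : Matrix ν ν ℂ), groupParam d A ∈ range ι ↔ A ∈ 𝔤 := by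
  have hc : Continuous fun A : Matrix ν ν ℂ => A - commInv d (offHerm d (comm d A)) :=
    continuous_id.sub ((commInv d).continuous.comp
      ((offHerm d).continuous.comp (comm d).continuous))
  have h0 := hc.tendsto 0
  rw [map_zero, map_zero, map_zero, sub_zero] at h0
  filter_upwards [h0.eventually h.mem_of_exp] with A hA
  have hK := h.commInv_mem _ (offHerm_mem d (comm d A))
  obtain ⟨g, hg⟩ := h.exp_mem _ hK
  rw [groupParam, ← hg, mul_mem_range_iff]
  refine ⟨fun h1 => ?_, fun h1 => h.exp_mem _ (sub_mem h1 hK)⟩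
  simpa using add_mem (hA h1) hK

end ActsTransitively

section Charts

variable {E F : Type*} [NormedAddCommGroup E] [NormedSpace ℝ E] [NormedAddCommGroup F]
  [NormedSpace ℝ F]

/-- The local inverse of `orbitParam` is a slice chart of the orbit around `D`. -/
theorem exists_orbitChart (d : ν → ℝ) (c : Matrix ν ν ℂ ≃L[ℝ] E × F)
    (hc : ∀ A, A ∈ tangent d ↔ (c A).2 = 0) :
    ∃ Φ : OpenPartialHomeomorph (Matrix ν ν ℂ) (E × F), IsSliceChart (orbit d) Φ ∧
      diagR d ∈ Φ.source ∧ (∀ᶠ A in 𝓝 0, Φ (orbitParam d A) = c A) ∧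
      ∀ z ∈ Φ.source, orbitParam d (c.symm (Φ z)) = z := by
  have := exists_sliceChart (contDiff_orbitParam d) (hasFDerivAt_orbitParam d)
    (eventually_orbitParam_mem_iff d) c hc
  rwa [orbitParam_zero] at this

/-- The local inverse of `groupParam` is a slice chart of the group around `1`. -/
theorem ActsTransitively.exists_groupChart (h : ActsTransitively d ι 𝔤)
    (c : Matrix ν ν ℂ ≃L[ℝ] E × F) (hc : ∀ A, A ∈ 𝔤 ↔ (c A).2 = 0) :
    ∃ Φ : OpenPartialHomeomorph (Matrix ν ν ℂ) (E × F), IsSliceChart (range ι) Φ ∧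
      1 ∈ Φ.source ∧ (∀ᶠ A in 𝓝 0, Φ (groupParam d A) = c A) ∧
      ∀ z ∈ Φ.source, groupParam d (c.symm (Φ z)) = z := by
  have := exists_sliceChart (contDiff_groupParam d) (hasFDerivAt_groupParam d)
    h.eventually_groupParam_mem_iff c hc
  rwa [groupParam_zero] at this

theorem translate_orbitChart {u : Matrix ν ν ℂ} (hu : u ∈ Matrix.unitaryGroup ν ℂ)
    {Φ : OpenPartialHomeomorph (Matrix ν ν ℂ) (E × F)} (hΦ : IsSliceChart (orbit d) Φ) :
    IsSliceChart (orbit d) ((conjEquiv hu).toHomeomorph.transOpenPartialHomeomorph Φ) :=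
  hΦ.translate (conjEquiv hu) fun y => conjEquiv_mem_orbit_iff d hu y

end Charts

namespace ActsTransitively

section

variable {E F : Type*} [NormedAddCommGroup E] [NormedSpace ℝ E] [NormedAddCommGroup F]
  [NormedSpace ℝ F]

theorem translate_groupChart (h : ActsTransitively d ι 𝔤) (g : G)
    {Φ : OpenPartialHomeomorph (Matrix ν ν ℂ) (E × F)} (hΦ : IsSliceChart (range ι) Φ) :
    IsSliceChart (range ι)
      ((leftEquiv (h.unitary g)).toHomeomorph.transOpenPartialHomeomorph Φ) :=
  hΦ.translate (leftEquiv (h.unitary g)) (h.leftEquiv_mem_range_iff g)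

end

variable {F : Type} [NormedAddCommGroup F] [NormedSpace ℝ F] {a : ℕ}

theorem hasSlices (h : ActsTransitively d ι 𝔤)
    (c : Matrix ν ν ℂ ≃L[ℝ] EuclideanSpace ℝ (Fin a) × F) (hc : ∀ A, A ∈ 𝔤 ↔ (c A).2 = 0) :
    HasSlices a F ι := by
  intro g
  obtain ⟨Φ, hΦ, h1, -⟩ := h.exists_groupChart c hc
  refine ⟨_, h.translate_groupChart g hΦ, ?_⟩
  change star (ι g) * ι g ∈ Φ.source
  rwa [Matrix.mem_unitaryGroup_iff'.1 (h.unitary g)]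

end ActsTransitively

theorem hasSlices_of_range_eq_orbit {F : Type} [NormedAddCommGroup F] [NormedSpace ℝ F] {a : ℕ}
    (c : Matrix ν ν ℂ ≃L[ℝ] EuclideanSpace ℝ (Fin a) × F)
    (hc : ∀ A, A ∈ tangent d ↔ (c A).2 = 0) {X : Type} [TopologicalSpace X]
    {j : X → Matrix ν ν ℂ} (hj : range j = orbit d) : HasSlices a F j := by
  intro x
  obtain ⟨u, hu, hx⟩ : j x ∈ orbit d := hj ▸ mem_range_self x
  obtain ⟨Φ, hΦ, h1, -⟩ := exists_orbitChart d c hc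
  refine ⟨_, hj ▸ translate_orbitChart hu hΦ, ?_⟩
  change conjEquiv hu (j x) ∈ Φ.source
  rwa [hx, conjEquiv_conj]

end Group

/-! ### The orbit map is a submersion -/

section Homogeneous

variable {ν : Type} [Fintype ν] [DecidableEq ν] {G : Type} [Group G] [TopologicalSpace G]
  {d : ν → ℝ} {ι : G →* Matrix ν ν ℂ} {𝔤 : Submodule ℝ (Matrix ν ν ℂ)}

theorem IsSliceChart.contDiffAt_translate {E F : Type*} [NormedAddCommGroup E] [NormedSpace ℝ E]
    [NormedAddCommGroup F] [NormedSpace ℝ F] {V : Type*} [NormedAddCommGroup V] [NormedSpace ℝ V]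
    {Y : Set V} {Φ : OpenPartialHomeomorph V (E × F)} (hΦ : IsSliceChart Y Φ) (e : V ≃L[ℝ] V)
    (c : V ≃L[ℝ] E × F) {B : V} (hB : e B ∈ Φ.source) :
    ContDiffAt ℝ ∞ (fun z => c.symm (Φ (e z))) B ∧ ∀ᶠ z in 𝓝 B, e z ∈ Φ.source := by
  have h1 : ContDiffAt ℝ ∞ Φ (e B) := hΦ.contDiffOn.contDiffAt (Φ.open_source.mem_nhds hB)
  exact ⟨c.symm.contDiff.contDiffAt.comp B (h1.comp B e.contDiff.contDiffAt),
    e.continuous.continuousAt.eventually_mem (Φ.open_source.mem_nhds hB)⟩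

namespace ActsTransitively

/-- The orbit map `g ↦ g D g⁻¹` has smooth local sections, given by smooth maps between the ambient
spaces of matrices. -/
theorem exists_section (h : ActsTransitively d ι 𝔤) {B : Matrix ν ν ℂ} (hB : B ∈ orbit d) :
    ∃ σ : Matrix ν ν ℂ → Matrix ν ν ℂ, ContDiffAt ℝ ∞ σ B ∧ ∀ᶠ z in 𝓝 B, z ∈ orbit d →
      σ z ∈ range ι ∧ σ z * diagR d * star (σ z) = z := by
  obtain ⟨g, rfl⟩ := h.transitive B hB
  obtain ⟨W', c, hc⟩ := exists_coordinates (tangent d)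
  obtain ⟨Φ, hΦ, h1, -, h3⟩ := exists_orbitChart d c hc
  have hg := h.unitary g
  have h0 : conjEquiv hg (ι g * diagR d * star (ι g)) ∈ Φ.source := by rwa [conjEquiv_conj]
  obtain ⟨h4, h5⟩ := hΦ.contDiffAt_translate (conjEquiv hg) c h0
  refine ⟨fun z => ι g * NormedSpace.exp (commInv d (c.symm (Φ (conjEquiv hg z)))), ?_, ?_⟩
  · exact contDiffAt_const.matrix_mul ((contDiff_exp_comp (commInv d)).contDiffAt.comp _ h4)
  · filter_upwards [h5] with z hz hzo
    have hm : c.symm (Φ (conjEquiv hg z)) ∈ tangent d := by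
      refine (hc _).2 ?_
      rw [c.apply_symm_apply]
      exact (hΦ.mem_iff _ hz).1 ((conjEquiv_mem_orbit_iff d hg z).2 hzo)
    have h6 := (orbitParam_of_mem hm).symm.trans (h3 _ hz)
    refine ⟨(mul_mem_range_iff g _).2 (h.exp_mem _ (h.commInv_mem _ hm)), ?_⟩
    have h7 := (congrArg (fun y => ι g * y * star (ι g)) h6).trans (conj_conjEquiv hg z)
    rw [star_mul]
    simpa only [mul_assoc] using h7

variable {F F' : Type} [NormedAddCommGroup F] [NormedSpace ℝ F] [NormedAddCommGroup F']
  [NormedSpace ℝ F'] {a b : ℕ}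

/-- The orbit map is a submersion: in suitable charts it is the linear map `comm d`, from the Lie
algebra onto the tangent space of the orbit. -/
theorem isSubmersion (h : ActsTransitively d ι 𝔤)
    (cG : Matrix ν ν ℂ ≃L[ℝ] EuclideanSpace ℝ (Fin a) × F) (hcG : ∀ A, A ∈ 𝔤 ↔ (cG A).2 = 0)
    (cX : Matrix ν ν ℂ ≃L[ℝ] EuclideanSpace ℝ (Fin b) × F')
    (hcX : ∀ A, A ∈ tangent d ↔ (cX A).2 = 0) {Q : Type} [TopologicalSpace Q] [Nonempty Q]
    {j : Q → Matrix ν ν ℂ} (hj : IsEmbedding j) (hjr : range j = orbit d) {f : G → Q}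
    (hfc : Continuous f) (hf : ∀ g, j (f g) = ι g * diagR d * star (ι g)) :
    letI := (h.hasSlices cG hcG).chartedSpace h.isEmbedding
    letI := (hasSlices_of_range_eq_orbit cX hcX hjr).chartedSpace hj
    Manifold.IsSubmersion (𝓡 a) (𝓡 b) ∞ f := by
  let := (h.hasSlices cG hcG).chartedSpace h.isEmbedding
  let := (hasSlices_of_range_eq_orbit cX hcX hjr).chartedSpace hj
  let l : EuclideanSpace ℝ (Fin a) →L[ℝ] EuclideanSpace ℝ (Fin b) :=
    ContinuousLinearMap.fst ℝ _ _ ∘L cX.toContinuousLinearMap ∘L comm d ∘L cG.symm.toContinuousLinearMap ∘L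
      ContinuousLinearMap.inl ℝ _ _
  have hl_apply : ∀ u, l u = (cX (comm d (cG.symm (u, 0)))).1 := fun _ => rfl
  have hl : l.range = ⊤ := by
    refine LinearMap.range_eq_top.2 fun v => ?_
    have hm : cX.symm (v, 0) ∈ tangent d := (hcX _).2 (by rw [cX.apply_symm_apply])
    have hg := (hcG _).1 (h.commInv_mem _ hm)
    refine ⟨(cG (commInv d (cX.symm (v, 0)))).1, ?_⟩
    have h1 : ((cG (commInv d (cX.symm (v, 0)))).1, (0 : F)) = cG (commInv d (cX.symm (v, 0))) :=
      Prod.ext rfl hg.symm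
    change l _ = v
    rw [hl_apply, h1, cG.symm_apply_apply, comm_commInv hm, cX.apply_symm_apply]
  refine Manifold.IsSubmersionOfComplement.isSubmersion (F := l.ker) fun g => ?_
  obtain ⟨Φ, hΦ, h1, h2, h3⟩ := h.exists_groupChart cG hcG
  obtain ⟨Φ', hΦ', h1', h2', h3'⟩ := exists_orbitChart d cX hcX
  have hg := h.unitary g
  have hΦg := h.translate_groupChart g hΦ
  have hΦg' : IsSliceChart (range j)
      ((conjEquiv hg).toHomeomorph.transOpenPartialHomeomorph Φ') :=
    hjr ▸ translate_orbitChart hg hΦ'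
  have e1 : leftEquiv hg (ι g) = 1 := Matrix.mem_unitaryGroup_iff'.1 hg
  have e2 : conjEquiv hg (j (f g)) = diagR d := by rw [hf, conjEquiv_conj]
  have hsrc : leftEquiv hg (ι g) ∈ Φ.source := by rwa [e1]
  obtain ⟨h4, h5⟩ := hΦ.contDiffAt_translate (leftEquiv hg) cG hsrc
  refine isSubmersionAtOfComplement_of_surjective hfc.continuousAt
    (HasSlices.chart_mem_maximalAtlas _ h.isEmbedding hΦg)
    (HasSlices.chart_mem_maximalAtlas _ hj hΦg') hsrc ?_ l hl ?_
  · change conjEquiv hg (j (f g)) ∈ Φ'.source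
    rwa [e2]
  · have hι : ContinuousAt ι g := h.isEmbedding.continuous.continuousAt
    have h6 : Filter.Tendsto (fun y => comm d (cG.symm (Φ (leftEquiv hg (ι y))))) (𝓝 g)
        (𝓝 0) := by
      have h7 : ContinuousAt (fun y => comm d (cG.symm (Φ (leftEquiv hg (ι y))))) g :=
        (comm d).continuous.continuousAt.comp (ContinuousAt.comp (f := ι) h4.continuousAt hι)
      have h8 : cG.symm (Φ (leftEquiv hg (ι g))) = 0 := by
        have h9 := h2.self_of_nhds
        rw [groupParam_zero, map_zero] at h9
        rw [e1, h9, map_zero]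
      have h10 := h7.tendsto
      rwa [h8, map_zero] at h10
    filter_upwards [h6.eventually h2', hι.eventually h5] with y hy hys
    set A := cG.symm (Φ (leftEquiv hg (ι y))) with hA
    have hzr : leftEquiv hg (ι y) ∈ range ι := (h.leftEquiv_mem_range_iff g _).2 ⟨y, rfl⟩
    have hc2 := (hΦ.mem_iff _ hys).1 hzr
    have hA𝔤 : A ∈ 𝔤 := (hcG _).2 (by
      rw [hA, cG.apply_symm_apply]
      exact hc2)
    have h11 : groupParam d A = leftEquiv hg (ι y) := h3 _ hys
    rw [← groupParam_conj (h.skew _ hA𝔤), h11] at hy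
    have h12 : leftEquiv hg (ι y) * diagR d * star (leftEquiv hg (ι y)) =
        conjEquiv hg (j (f y)) := by
      rw [hf, leftEquiv_apply, conjEquiv_apply, star_mul, star_star]
      simp only [mul_assoc]
    rw [h12] at hy
    change (Φ' (conjEquiv hg (j (f y)))).1 = l (Φ (leftEquiv hg (ι y))).1
    rw [hy, hl_apply]
    exact congrArg (fun u => (cX (comm d (cG.symm u))).1) (hΦ.eq_of_mem hys hzr)

end ActsTransitively

end Homogeneous

/-! ### The coset space as the orbit -/

section Lift

variable {V : Type} [NormedAddCommGroup V] [NormedSpace ℝ V] {G : Type} [Group G]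
  [TopologicalSpace G] {H : Subgroup G} {X : Type} [TopologicalSpace X] {ι : G → V} {j : X → V}

theorem SmoothStructure.IsEmbeddedBy.isEmbedding {D : SmoothStructure X}
    (hD : D.IsEmbeddedBy j) : IsEmbedding j := by
  let := D.charted
  have hD' : Manifold.IsSmoothEmbedding (𝓡 D.dim) 𝓘(ℝ, V) ∞ j := hD
  exact hD'.isEmbedding

/-- A bijection `φ` from a coset space of `G` to `X` is a diffeomorphism if it comes from a smooth
map `P` of the ambient space and has local lifts `s : X → G` that come from smooth maps `σ`. -/
theorem diffeomorphic_of_lift {φ : G ⧸ H ≃ X} {P : V → V} (hP : ContDiff ℝ ∞ P)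
    (hφ : ∀ g : G, j (φ g) = P (ι g)) (hφc : Continuous φ)
    (hlift : ∀ x, ∃ (s : X → G) (σ : V → V), ContinuousAt s x ∧
      ContDiffAt ℝ ∞ σ (j x) ∧ (ι ∘ s =ᶠ[𝓝 x] σ ∘ j) ∧ ∀ᶠ y in 𝓝 x, φ (s y) = y)
    {A : SmoothStructure G} {B : SmoothStructure (G ⧸ H)} {D : SmoothStructure X}
    (hD : D.IsEmbeddedBy j) (hA : A.IsEmbeddedBy ι) (hB : B.IsQuotientOf A) :
    B.Diffeomorphic D := by
  let := A.charted
  let := B.charted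
  let := D.charted
  have hD' : Manifold.IsSmoothEmbedding (𝓡 D.dim) 𝓘(ℝ, V) ∞ j := hD
  have hA' : Manifold.IsSmoothEmbedding (𝓡 A.dim) 𝓘(ℝ, V) ∞ ι := hA
  have hB' : Manifold.IsSubmersion (𝓡 A.dim) (𝓡 B.dim) ∞ (QuotientGroup.mk : G → G ⧸ H) := hB
  have h1 : ContMDiff (𝓡 A.dim) (𝓡 D.dim) ∞ (fun g : G => φ g) := by
    rw [ContMDiff.iff_comp_isImmersion hD'.isImmersion]
    refine ⟨hφc.comp continuous_quotient_mk', ?_⟩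
    have h2 : (j ∘ fun g : G => φ g) = P ∘ ι := funext hφ
    rw [h2]
    exact hP.contMDiff.comp hA'.contMDiff
  refine ⟨⟨φ, fun q => ?_, fun x => ?_⟩⟩
  · obtain ⟨g, rfl⟩ := QuotientGroup.mk_surjective q
    obtain ⟨s, -, hs, hs2⟩ := exists_local_section (hB'.isSubmersionAt g)
    refine (ContMDiffAt.comp _ (h1 _) hs).congr_of_eventuallyEq ?_
    filter_upwards [hs2] with z hz
    exact congrArg φ hz.symm
  · obtain ⟨s, σ, hs, hσ, hs2, hs3⟩ := hlift x
    have h3 : ContMDiffAt (𝓡 D.dim) (𝓡 A.dim) ∞ s x := by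
      rw [ContMDiffAt.iff_comp_isImmersionAt (hA'.isImmersion.isImmersionAt (s x))]
      refine ⟨hs, ContMDiffAt.congr_of_eventuallyEq ?_ hs2⟩
      exact ContMDiffAt.comp x hσ.contMDiffAt (hD'.contMDiff x)
    refine (ContMDiffAt.comp x (hB'.contMDiff _) h3).congr_of_eventuallyEq ?_
    filter_upwards [hs3] with y hy
    exact (Equiv.symm_apply_eq φ).2 hy.symm

end Lift

section Coset

variable {ν : Type} [Fintype ν] [DecidableEq ν] {G : Type} [Group G] [TopologicalSpace G]
  {d : ν → ℝ} {ι : G →* Matrix ν ν ℂ} {𝔤 : Submodule ℝ (Matrix ν ν ℂ)} {H : Subgroup G}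
  {X : Type} [TopologicalSpace X] {j : X → Matrix ν ν ℂ}

namespace ActsTransitively

theorem conj_eq_conj_iff (h : ActsTransitively d ι 𝔤)
    (hH : ∀ g, g ∈ H ↔ ι g * diagR d = diagR d * ι g) (g g' : G) :
    ι g * diagR d * star (ι g) = ι g' * diagR d * star (ι g') ↔ g⁻¹ * g' ∈ H := by
  have e : ∀ g : G, ι g * ι g⁻¹ = 1 := fun g => by rw [← map_mul, mul_inv_cancel, map_one]
  have e' : ∀ g : G, ι g⁻¹ * ι g = 1 := fun g => by rw [← map_mul, inv_mul_cancel, map_one]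
  rw [hH, map_mul, ← h.map_inv, ← h.map_inv]
  constructor
  · intro h1
    calc ι g⁻¹ * ι g' * diagR d = ι g⁻¹ * (ι g' * diagR d * ι g'⁻¹) * ι g' := by
          simp only [mul_assoc, e', mul_one]
      _ = (ι g⁻¹ * ι g) * diagR d * (ι g⁻¹ * ι g') := by
          rw [← h1]
          simp only [mul_assoc]
      _ = _ := by rw [e', one_mul]
  · intro h1
    calc ι g * diagR d * ι g⁻¹ = ι g * (diagR d * (ι g⁻¹ * ι g')) * ι g'⁻¹ := by
          simp only [mul_assoc, e, mul_one]
      _ = (ι g * ι g⁻¹) * (ι g' * diagR d * ι g'⁻¹) := by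
          rw [← h1]
          simp only [mul_assoc]
      _ = _ := by rw [e, one_mul]

omit [TopologicalSpace X] in
/-- The bijection from the coset space of the stabilizer of `D` onto the orbit of `D`. -/
theorem exists_equiv (h : ActsTransitively d ι 𝔤)
    (hH : ∀ g, g ∈ H ↔ ι g * diagR d = diagR d * ι g) (hj : Injective j)
    (hjr : range j = orbit d) :
    ∃ φ : G ⧸ H ≃ X, ∀ g : G, j (φ g) = ι g * diagR d * star (ι g) := by
  have hex : ∀ q : G ⧸ H, ∃ x : X, ∀ g : G, (g : G ⧸ H) = q →
      j x = ι g * diagR d * star (ι g) := by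
    intro q
    induction q using QuotientGroup.induction_on with | H g =>
    obtain ⟨x, hx⟩ : ι g * diagR d * star (ι g) ∈ range j := hjr ▸ ⟨ι g, h.unitary g, rfl⟩
    refine ⟨x, fun g' hg' => ?_⟩
    rw [hx, h.conj_eq_conj_iff hH]
    exact QuotientGroup.eq.1 hg'.symm
  choose f hf using hex
  refine ⟨Equiv.ofBijective f ⟨fun q q' hqq => ?_, fun x => ?_⟩, fun g => hf _ g rfl⟩
  · induction q using QuotientGroup.induction_on with | H g =>
    induction q' using QuotientGroup.induction_on with | H g' =>
    have h1 := congrArg j hqq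
    rw [hf _ g rfl, hf _ g' rfl, h.conj_eq_conj_iff hH] at h1
    exact QuotientGroup.eq.2 h1
  · obtain ⟨g, hg⟩ := h.transitive (j x) (hjr ▸ mem_range_self x)
    exact ⟨g, hj (by rw [hf _ g rfl, hg])⟩

theorem contDiff_conj : ContDiff ℝ ∞ fun A : Matrix ν ν ℂ => A * diagR d * star A :=
  (contDiff_id.matrix_mul contDiff_const).matrix_mul contDiff_conjTranspose

theorem continuous_equiv (h : ActsTransitively d ι 𝔤) (hj : IsEmbedding j) {φ : G ⧸ H ≃ X}
    (hφ : ∀ g : G, j (φ g) = ι g * diagR d * star (ι g)) : Continuous φ := by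
  rw [hj.isInducing.continuous_iff, isQuotientMap_quotient_mk'.continuous_iff]
  have h1 : j ∘ φ ∘ (QuotientGroup.mk : G → G ⧸ H) = (fun A => A * diagR d * star A) ∘ ι :=
    funext hφ
  exact h1 ▸ contDiff_conj.continuous.comp h.isEmbedding.continuous

/-- Local sections of the orbit map, lifted to the group. -/
theorem exists_lift (h : ActsTransitively d ι 𝔤) (hj : IsEmbedding j) (hjr : range j = orbit d)
    {φ : G ⧸ H ≃ X} (hφ : ∀ g : G, j (φ g) = ι g * diagR d * star (ι g)) (x : X) :
    ∃ (s : X → G) (σ : Matrix ν ν ℂ → Matrix ν ν ℂ), ContinuousAt s x ∧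
      ContDiffAt ℝ ∞ σ (j x) ∧ (ι ∘ s =ᶠ[𝓝 x] σ ∘ j) ∧ ∀ᶠ y in 𝓝 x, φ (s y) = y := by
  have hor : ∀ y, j y ∈ orbit d := fun y => hjr ▸ mem_range_self y
  obtain ⟨σ, hσ, hσ2⟩ := h.exists_section (hor x)
  have hjc : ContinuousAt j x := hj.continuous.continuousAt
  have h1 : ∀ᶠ y in 𝓝 x, ι (invFun ι (σ (j y))) = σ (j y) := by
    filter_upwards [hjc.eventually hσ2] with y hy
    exact invFun_eq (hy (hor y)).1
  refine ⟨fun y => invFun ι (σ (j y)), σ, ?_, hσ, h1, ?_⟩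
  · rw [h.isEmbedding.isInducing.continuousAt_iff]
    exact (ContinuousAt.comp (f := j) hσ.continuousAt hjc).congr (h1.mono fun y hy => hy.symm)
  · filter_upwards [h1, hjc.eventually hσ2] with y hy hy2
    refine hj.injective ?_
    rw [hφ, hy]
    exact (hy2 (hor y)).2

/-- The bijection is a homeomorphism because the orbit map has continuous local sections. -/
theorem continuous_equiv_symm (h : ActsTransitively d ι 𝔤) (hj : IsEmbedding j)
    (hjr : range j = orbit d) {φ : G ⧸ H ≃ X}
    (hφ : ∀ g : G, j (φ g) = ι g * diagR d * star (ι g)) : Continuous φ.symm := by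
  refine continuous_iff_continuousAt.2 fun x => ?_
  obtain ⟨s, σ, hs, -, -, h2⟩ := h.exists_lift hj hjr hφ x
  have h3 : ContinuousAt (fun y => (s y : G ⧸ H)) x :=
    continuous_quotient_mk'.continuousAt.comp hs
  refine h3.congr ?_
  filter_upwards [h2] with y hy
  rw [Equiv.eq_symm_apply, hy]

/-- The smooth structures on the group and on the coset space exist. -/
theorem exists_structures (h : ActsTransitively d ι 𝔤)
    (hH : ∀ g, g ∈ H ↔ ι g * diagR d = diagR d * ι g) :
    ∃ (A : SmoothStructure G) (B : SmoothStructure (G ⧸ H)),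
      A.IsEmbeddedBy ι ∧ B.IsQuotientOf A := by
  obtain ⟨F, cG, hcG⟩ := exists_coordinates 𝔤
  obtain ⟨F', cX, hcX⟩ := exists_coordinates (tangent d)
  have hval : range (Subtype.val : orbit d → Matrix ν ν ℂ) = orbit d := Subtype.range_val
  obtain ⟨φ, hφ⟩ := h.exists_equiv hH (j := (Subtype.val : orbit d → Matrix ν ν ℂ))
    Subtype.val_injective hval
  let ψ : G ⧸ H ≃ₜ orbit d := ⟨φ, h.continuous_equiv IsEmbedding.subtypeVal hφ,
    h.continuous_equiv_symm IsEmbedding.subtypeVal hval hφ⟩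
  have hj : IsEmbedding fun q => (ψ q : Matrix ν ν ℂ) :=
    IsEmbedding.subtypeVal.comp ψ.isEmbedding
  have hjr : (range fun q => (ψ q : Matrix ν ν ℂ)) = orbit d :=
    (ψ.surjective.range_comp _).trans hval
  exact ⟨(h.hasSlices cG hcG).smoothStructure h.isEmbedding,
    (hasSlices_of_range_eq_orbit cX hcX hjr).smoothStructure hj,
    HasSlices.isEmbeddedBy _ _ cG.symm,
    h.isSubmersion cG hcG cX hcX hj hjr continuous_quotient_mk' hφ⟩

/-- Whatever the atlases, the coset space of the stabilizer of `D` is diffeomorphic to the orbit. -/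
theorem diffeomorphic (h : ActsTransitively d ι 𝔤)
    (hH : ∀ g, g ∈ H ↔ ι g * diagR d = diagR d * ι g) (hjr : range j = orbit d)
    {A : SmoothStructure G} {B : SmoothStructure (G ⧸ H)} {D : SmoothStructure X}
    (hD : D.IsEmbeddedBy j) (hA : A.IsEmbeddedBy ι) (hB : B.IsQuotientOf A) :
    B.Diffeomorphic D := by
  have hj : IsEmbedding j := hD.isEmbedding
  obtain ⟨φ, hφ⟩ := h.exists_equiv hH hj.injective hjr
  exact diffeomorphic_of_lift contDiff_conj hφ (h.continuous_equiv hj hφ)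
    (h.exists_lift hj hjr hφ) hD hA hB

end ActsTransitively

end Coset

/-! ### The unitary and the special unitary group -/

section Instances

variable {ν : Type} [Fintype ν] [DecidableEq ν]

/-- The Lie algebra of the unitary group: the skew-Hermitian matrices. -/
noncomputable def unitaryLie (ν : Type) [Fintype ν] : Submodule ℝ (Matrix ν ν ℂ) :=
  skewAdjoint.submodule ℝ (Matrix ν ν ℂ)

/-- The Lie algebra of the special unitary group: the skew-Hermitian matrices of trace `0`. -/
noncomputable def specialUnitaryLie (ν : Type) [Fintype ν] : Submodule ℝ (Matrix ν ν ℂ) :=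
  unitaryLie ν ⊓ (Matrix.traceLinearMap ν ℝ ℂ).ker

omit [DecidableEq ν] in
theorem mem_specialUnitaryLie {A : Matrix ν ν ℂ} :
    A ∈ specialUnitaryLie ν ↔ Aᴴ = -A ∧ A.trace = 0 := Iff.rfl

theorem actsTransitively_unitary (d : ν → ℝ) :
    ActsTransitively d (Matrix.unitaryGroup ν ℂ).subtype (unitaryLie ν) where
  isEmbedding := IsEmbedding.subtypeVal
  unitary g := g.2
  skew _ hA := hA
  exp_mem _ hA := ⟨⟨_, exp_mem_unitary hA⟩, rfl⟩
  mem_of_exp := by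
    filter_upwards [eventually_skew_of_exp_unitary (ν := ν)] with A hA
    rintro ⟨g, hg⟩
    exact hA (hg ▸ g.2)
  commInv_mem _ hB := commInv_skew hB.1
  transitive := by
    rintro _ ⟨u, hu, rfl⟩
    exact ⟨⟨u, hu⟩, rfl⟩

/-- A unitary matrix is a scalar multiple, by a number of modulus `1`, of one of determinant `1`. -/
theorem exists_smul_mem_specialUnitary {u : Matrix ν ν ℂ} (hu : u ∈ Matrix.unitaryGroup ν ℂ) :
    ∃ z : ℂ, z * star z = 1 ∧ z • u ∈ Matrix.specialUnitaryGroup ν ℂ := by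
  rcases isEmpty_or_nonempty ν with hν | hν
  · exact ⟨1, by simp, by simp [Matrix.mem_specialUnitaryGroup_iff, hu]⟩
  have hdet : u.det * star u.det = 1 := by
    rw [← Matrix.det_conjTranspose, ← Matrix.det_mul, ← Matrix.star_eq_conjTranspose,
      Matrix.mem_unitaryGroup_iff.1 hu, Matrix.det_one]
  -- `det (z • u) = z ^ card ν * det u`, and the inverse of `det u` is its conjugate.
  obtain ⟨z, hz⟩ := IsAlgClosed.exists_pow_nat_eq (star u.det) (Fintype.card_pos (α := ν))
  have hz1 : z * star z = 1 := by
    have h1 : ‖u.det‖ = 1 := by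
      have := congrArg norm hdet
      rw [norm_mul, norm_star, norm_one] at this
      nlinarith [norm_nonneg u.det]
    have h2 : ‖z‖ = 1 := by
      have := congrArg norm hz
      rw [norm_pow, norm_star, h1] at this
      exact (pow_eq_one_iff_of_nonneg (norm_nonneg z) Fintype.card_ne_zero).1 this
    rw [Complex.star_def, Complex.mul_conj, Complex.normSq_eq_norm_sq, h2]
    simp
  refine ⟨z, hz1, Matrix.mem_specialUnitaryGroup_iff.2 ⟨?_, ?_⟩⟩
  · rw [Matrix.mem_unitaryGroup_iff, star_smul, Matrix.smul_mul, Matrix.mul_smul, smul_smul, hz1,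
      one_smul, Matrix.mem_unitaryGroup_iff.1 hu]
  · rw [Matrix.det_smul, hz, mul_comm, hdet]

theorem actsTransitively_specialUnitary (d : ν → ℝ) :
    ActsTransitively d (Matrix.specialUnitaryGroup ν ℂ).subtype (specialUnitaryLie ν) where
  isEmbedding := IsEmbedding.subtypeVal
  unitary g := g.2.1
  skew _ hA := hA.1
  exp_mem A hA := by
    refine ⟨⟨_, Matrix.mem_specialUnitaryGroup_iff.2 ⟨exp_mem_unitary hA.1, ?_⟩⟩, rfl⟩
    rw [det_exp_of_skew hA.1, (mem_specialUnitaryLie.1 hA).2, Complex.exp_zero]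
  mem_of_exp := by
    filter_upwards [eventually_skew_of_exp_unitary (ν := ν),
      eventually_trace_eq_zero_of_det_exp (ν := ν)] with A hA hA'
    rintro ⟨g, hg⟩
    have h0 : NormedSpace.exp A ∈ Matrix.specialUnitaryGroup ν ℂ := by
      rw [← hg]
      exact g.2
    have h1 := Matrix.mem_specialUnitaryGroup_iff.1 h0
    exact mem_specialUnitaryLie.2 ⟨hA h1.1, hA' (hA h1.1) h1.2⟩
  commInv_mem _ hB := mem_specialUnitaryLie.2 ⟨commInv_skew hB.1, trace_commInv _⟩
  transitive := by
    rintro _ ⟨u, hu, rfl⟩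
    obtain ⟨z, hz, hzu⟩ := exists_smul_mem_specialUnitary hu
    refine ⟨⟨_, hzu⟩, ?_⟩
    change z • u * diagR d * star (z • u) = _
    rw [star_smul, Matrix.smul_mul, Matrix.smul_mul, Matrix.mul_smul, smul_smul, hz, one_smul]

end Instances

/-! ### Isospectral matrices and block-diagonal matrices -/

section Blocks

variable {n k : ℕ}

/-- The diagonal entries of `diagMatrix p m hm`, as real numbers. -/
def diagEntries (p : Fin k → ℝ) (m : Fin k → ℕ) (hm : ∑ i, m i = n) (a : Fin n) : ℝ :=
  p ((blockEquiv m hm).symm a).1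

variable (p : Fin k → ℝ) (m : Fin k → ℕ) (hm : ∑ i, m i = n)

theorem diagMatrix_eq : diagMatrix p m hm = diagR (diagEntries p m hm) := rfl

theorem unitaryOrbit_eq : unitaryOrbit (diagMatrix p m hm) = orbit (diagEntries p m hm) := by
  ext B
  constructor
  · rintro ⟨g, rfl⟩
    exact ⟨g, g.2, rfl⟩
  · rintro ⟨u, hu, rfl⟩
    exact ⟨⟨u, hu⟩, rfl⟩

theorem roots_charpoly_diagMatrix :
    (diagMatrix p m hm).charpoly.roots = ∑ i, m i • ({(p i : ℂ)} : Multiset ℂ) := by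
  rw [diagMatrix, Matrix.charpoly_diagonal, Polynomial.roots_prod _ _
    (Finset.prod_ne_zero_iff.2 fun _ _ => Polynomial.X_sub_C_ne_zero _)]
  simp_rw [Polynomial.roots_X_sub_C]
  rw [Multiset.bind, Multiset.join]
  change ∑ a, ({((p ((blockEquiv m hm).symm a).1 : ℝ) : ℂ)} : Multiset ℂ) = _
  rw [Equiv.sum_comp (blockEquiv m hm).symm fun x => ({((p x.1 : ℝ) : ℂ)} : Multiset ℂ),
    Fintype.sum_sigma]
  simp

theorem charpoly_eq_of_mem_isospectral {ρ : Matrix (Fin n) (Fin n) ℂ}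
    (hρ : ρ ∈ isospectral n p m) : ρ.charpoly = (diagMatrix p m hm).charpoly := by
  rw [(IsAlgClosed.splits ρ.charpoly).eq_prod_roots_of_monic ρ.charpoly_monic,
    (IsAlgClosed.splits (diagMatrix p m hm).charpoly).eq_prod_roots_of_monic
      (diagMatrix p m hm).charpoly_monic, hρ.2, roots_charpoly_diagMatrix]

/-- By the spectral theorem, Hermitian matrices with the same spectrum are unitarily conjugate. -/
theorem isospectral_eq_orbit : isospectral n p m = orbit (diagEntries p m hm) := by
  ext ρ
  constructor
  · intro hρ
    have hD : (diagMatrix p m hm).IsHermitian := diagR_isHermitian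
    have he := (hρ.1.eigenvalues_eq_eigenvalues_iff hD).2 (charpoly_eq_of_mem_isospectral p m hm hρ)
    have h1 := hρ.1.spectral_theorem
    have h2 := hD.spectral_theorem
    rw [Unitary.conjStarAlgAut_apply] at h1 h2
    rw [he] at h1
    set v := hρ.1.eigenvectorUnitary
    set w := hD.eigenvectorUnitary
    set Λ := Matrix.diagonal (RCLike.ofReal ∘ hD.eigenvalues : Fin n → ℂ)
    have hw : star (w : Matrix (Fin n) (Fin n) ℂ) * w = 1 := Matrix.mem_unitaryGroup_iff'.1 w.2
    refine ⟨(v : Matrix (Fin n) (Fin n) ℂ) * star (w : Matrix (Fin n) (Fin n) ℂ), mul_mem v.2 (Unitary.star_mem w.2), ?_⟩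
    rw [← diagMatrix_eq, h2, h1]
    calc _ = (v : Matrix (Fin n) (Fin n) ℂ) * (star (w : Matrix (Fin n) (Fin n) ℂ) * w) * Λ *
          (star (w : Matrix (Fin n) (Fin n) ℂ) * w) * star (v : Matrix (Fin n) (Fin n) ℂ) := by
          rw [hw, mul_one, mul_one]
      _ = _ := by simp only [star_mul, star_star, mul_assoc]
  · intro hρ
    refine ⟨isHermitian_of_mem_orbit hρ, ?_⟩
    obtain ⟨u, hu, rfl⟩ := hρ
    rw [Matrix.charpoly_mul_comm, ← mul_assoc, Matrix.mem_unitaryGroup_iff'.1 hu, one_mul,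
      ← diagMatrix_eq, roots_charpoly_diagMatrix]

theorem mul_diagR_eq_iff {ν : Type} [Fintype ν] [DecidableEq ν] {d : ν → ℝ} {A : Matrix ν ν ℂ} :
    A * diagR d = diagR d * A ↔ ∀ a b, d a ≠ d b → A a b = 0 := by
  rw [← sub_eq_zero, ← comm_eq]
  constructor
  · intro h a b hab
    have := congr_fun₂ h a b
    rw [comm_apply, Matrix.zero_apply, mul_eq_zero, sub_eq_zero] at this
    exact this.resolve_right fun h => hab (by exact_mod_cast h.symm)
  · intro h
    ext a b
    rw [comm_apply, Matrix.zero_apply]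
    by_cases hab : d a = d b
    · rw [hab, sub_self, mul_zero]
    · rw [h a b hab, zero_mul]

variable {p} in
/-- The block-diagonal matrices are the stabilizer of `D`. -/
theorem mem_blockU_iff (hp : Injective p) (g : U n) :
    g ∈ blockU m hm ↔ (g : Matrix (Fin n) (Fin n) ℂ) * diagR (diagEntries p m hm) =
      diagR (diagEntries p m hm) * g := by
  rw [mul_diagR_eq_iff]
  set e := blockEquiv m hm
  constructor
  · rintro ⟨u, rfl⟩ a b hab
    change Matrix.blockDiagonal' (fun i => (u i : Matrix (Fin (m i)) (Fin (m i)) ℂ))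
      (e.symm a) (e.symm b) = 0
    rw [Matrix.blockDiagonal'_apply, dif_neg]
    exact fun h => hab (congrArg p h)
  · intro h
    let M : ∀ i, Matrix (Fin (m i)) (Fin (m i)) ℂ := fun i x y => g.1 (e ⟨i, x⟩) (e ⟨i, y⟩)
    have hM : Matrix.blockDiagonal' M = Matrix.reindexAlgEquiv ℂ ℂ e.symm g.1 := by
      ext ⟨i, x⟩ ⟨i', y⟩
      rw [Matrix.coe_reindexAlgEquiv, Matrix.reindex_apply, Matrix.submatrix_apply]
      by_cases hii : i = i'
      · subst hii
        rw [Matrix.blockDiagonal'_apply_eq]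
        rfl
      · rw [Matrix.blockDiagonal'_apply_ne _ _ _ hii, h]
        · intro hpp
          refine hii (hp ?_)
          simpa [diagEntries, e] using hpp
    have hMu : ∀ i, M i ∈ Matrix.unitaryGroup (Fin (m i)) ℂ := by
      have h1 : Matrix.blockDiagonal' (fun i => M i * (M i)ᴴ) = 1 := by
        rw [Matrix.blockDiagonal'_mul, ← Matrix.blockDiagonal'_conjTranspose, hM,
          Matrix.coe_reindexAlgEquiv, Matrix.conjTranspose_reindex, ← Matrix.coe_reindexAlgEquiv ℂ ℂ,
          ← map_mul, ← Matrix.star_eq_conjTranspose, Matrix.mem_unitaryGroup_iff.1 g.2, map_one]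
      rw [← Matrix.blockDiagonal'_one] at h1
      exact fun i => Matrix.mem_unitaryGroup_iff.2 (congrFun (Matrix.blockDiagonal'_injective h1) i)
    refine ⟨fun i => ⟨M i, hMu i⟩, Subtype.ext ?_⟩
    change Matrix.reindex e e (Matrix.blockDiagonal' M) = g.1
    rw [hM]
    ext a b
    simp

end Blocks

end FlagOrbit

open FlagOrbit in
/-- `𝒟(σ)` is the `U(n)`-orbit of a diagonal matrix; it is an embedded submanifold of the space of
matrices, and it is diffeomorphic to `U(n) / (U(m₁) × ⋯ × U(m_k))`, which is diffeomorphic to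
`SU(n) / S(U(m₁) × ⋯ × U(m_k))`. The smooth structures are the standard ones (as embedded
submanifolds and as quotients); they are asserted to exist, and the diffeomorphisms are asserted
for any choice of atlases defining them. -/
theorem mainTheorem1 (n k : ℕ) (p : Fin k → ℝ) (hp : Function.Injective p)
    (m : Fin k → ℕ) (hpos : ∀ i, 0 < m i) (hm : ∑ i, m i = n) :
    isospectral n p m = unitaryOrbit (diagMatrix p m hm) ∧
    (∃ D : SmoothStructure (isospectral n p m), D.IsEmbeddedBy (Subtype.val : isospectral n p m → Matrix (Fin n) (Fin n) ℂ)) ∧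
    (∃ (A : SmoothStructure (U n))
      (B : SmoothStructure (U n ⧸ blockU m hm)), A.IsEmbeddedBy (Subtype.val : U n → Matrix (Fin n) (Fin n) ℂ) ∧ B.IsQuotientOf A) ∧
    (∃ (A' : SmoothStructure (SU n))
      (B' : SmoothStructure (SU n ⧸ blockSU m hm)), A'.IsEmbeddedBy (Subtype.val : SU n → Matrix (Fin n) (Fin n) ℂ) ∧ B'.IsQuotientOf A') ∧
    ∀ (D : SmoothStructure (isospectral n p m))
      (A : SmoothStructure (U n))
      (B : SmoothStructure (U n ⧸ blockU m hm))
      (A' : SmoothStructure (SU n))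
      (B' : SmoothStructure (SU n ⧸ blockSU m hm)),
      D.IsEmbeddedBy (Subtype.val : isospectral n p m → Matrix (Fin n) (Fin n) ℂ) → A.IsEmbeddedBy (Subtype.val : U n → Matrix (Fin n) (Fin n) ℂ) → B.IsQuotientOf A → A'.IsEmbeddedBy (Subtype.val : SU n → Matrix (Fin n) (Fin n) ℂ) → B'.IsQuotientOf A' →
      B.Diffeomorphic D ∧ B.Diffeomorphic B' := by
  have hor := isospectral_eq_orbit p m hm
  have hU := actsTransitively_unitary (diagEntries p m hm)
  have hSU := actsTransitively_specialUnitary (diagEntries p m hm)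
  have hHU := mem_blockU_iff m hm hp
  have hHSU : ∀ g : SU n, g ∈ blockSU m hm ↔
      (g : Matrix (Fin n) (Fin n) ℂ) * diagR (diagEntries p m hm) =
        diagR (diagEntries p m hm) * g := fun g => hHU (inclSU n g)
  have hrange : Set.range (Subtype.val : isospectral n p m → Matrix (Fin n) (Fin n) ℂ) =
      orbit (diagEntries p m hm) := Subtype.range_val.trans hor
  refine ⟨hor.trans (unitaryOrbit_eq p m hm).symm, ?_, hU.exists_structures hHU,
    hSU.exists_structures hHSU, fun D A B A' B' hD hA hB hA' hB' => ?_⟩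
  · obtain ⟨F, c, hc⟩ := exists_coordinates (tangent (diagEntries p m hm))
    have hne : Nonempty (isospectral n p m) :=
      ⟨⟨diagMatrix p m hm, diagR_isHermitian, roots_charpoly_diagMatrix p m hm⟩⟩
    exact ⟨(hasSlices_of_range_eq_orbit c hc hrange).smoothStructure
      Topology.IsEmbedding.subtypeVal, HasSlices.isEmbeddedBy _ _ c.symm⟩
  · have h1 : B.Diffeomorphic D := hU.diffeomorphic hHU hrange hD hA hB
    have h2 : B'.Diffeomorphic D := hSU.diffeomorphic hHSU hrange hD hA' hB'
    let := B.charted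
    let := D.charted
    let := B'.charted
    obtain ⟨f⟩ := h1
    obtain ⟨f'⟩ := h2
    exact ⟨⟨f⟩, ⟨f.trans f'.symm⟩⟩
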